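/- Let $d\ge 2$ and let $S^d\subset\mathbb R^{d+1}$ be the unit sphere with its normalized (probability) surface measure. For $\ell\in\mathbb N_0$ let $n_{\ell d}=\frac{2\ell+d-1}{\ell}\binom{\ell+d-2}{\ell-1}$ (with $n_{0d}=1$) be the dimension of the space of real eigenfunctions of the Laplace--Beltrami operator, $\Delta_{S^d}f=-\ell(\ell+d-1)f$, and let $Y_{\ell 1},\dots,Y_{\ell n_{\ell d}}$ be any orthonormal basis of this space in $L^2(S^d)$ for the normalized measure. For a vector $\alpha=(\alpha_1,\dots,\alpha_{n_{\ell d}})$ in the unit sphere of $\mathbb R^{n_{\ell d}}$ put $h_{\alpha,\ell,d}=\sum_{m=1}^{n_{\ell d}}\alpha_m Y_{\ell m}$, and let $\mu_\ell$ be the uniform probability measure on that unit sphere. Let $X$ be uniformly distributed on $S^d$, let $Z$ be a standard Gaussian random variable, and let $d_{\mathrm{Kol}}(h_{\alpha,\ell,d}(X),Z)=\sup_{u\in\mathbb R}|P(h_{\alpha,\ell,d}(X)\le u)-P(Z\le u)|$ be the Kolmogorov distance of their laws. Then there is a universal constant $K>0$ such that for all $d\ge 2$, all $\ell\ge 0$,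 every such basis and all $\varepsilon>0$, $$\mu_\ell\{\alpha : d_{\mathrm{Kol}}(h_{\alpha,\ell,d}(X),Z)>\varepsilon\}\le\frac{K}{n_{\ell d}\,\varepsilon^3}.$$ Moreover, for each fixed $d\ge2$ and every positive sequence $(\varepsilon_\ell)_{\ell}$, $$\frac{K}{n_{\ell d}\,\varepsilon_\ell^3}=O\!\left(\frac{1}{\ell^{d-1}\varepsilon_\ell^3}\right)\qquad(\ell\to\infty),$$ and for each fixed $\ell\ge0$ and every positive sequence $(\varepsilon_d)_d$, $$\frac{K}{n_{\ell d}\,\varepsilon_d^3}=O\!\left(\frac{1}{d^{\ell}\varepsilon_d^3}\right)\qquad(d\to\infty).$$ -/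

import Mathlib

open MeasureTheory ProbabilityTheory Filter Asymptotics
open scoped Manifold ContDiff

noncomputable section

namespace SphericalHarmonics

/-- The unit sphere of `ℝ^n` (so that `S^d` is `USphere (d + 1)`). -/
abbrev USphere (n : ℕ) : Type := Metric.sphere (0 : EuclideanSpace ℝ (Fin n)) 1

/-- The normalized Lebesgue (surface) measure on the unit sphere of `ℝ^n`, that is, the
uniform distribution on that sphere. -/
def unif (n : ℕ) : Measure (USphere n) :=
  ((volume : Measure (EuclideanSpace ℝ (Fin n))).toSphere Set.univ)⁻¹ •
    (volume : Measure (EuclideanSpace ℝ (Fin n))).toSphere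

/-- The extension `x ↦ f (x / ‖x‖)` to `ℝ^n ∖ {0}` of a function on the unit sphere
(the value at the origin is irrelevant). -/
def radialExt {n : ℕ} (f : USphere n → ℝ) (x : EuclideanSpace ℝ (Fin n)) : ℝ :=
  open Classical in
  if h : x = 0 then 0 else
    f ⟨‖x‖⁻¹ • x, by
      rw [mem_sphere_zero_iff_norm, norm_smul, norm_inv, norm_norm,
        inv_mul_cancel₀ (norm_ne_zero_iff.mpr h)]⟩

/-- The Laplace-Beltrami operator of the round unit sphere, applied to a smooth function `f`:
the Euclidean Laplacian of the extension of `f` that is constant along rays,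
evaluated on the sphere. -/
def laplaceBeltrami {n : ℕ} (f : USphere n → ℝ) (x : USphere n) : ℝ :=
  Laplacian.laplacian (radialExt f) (x : EuclideanSpace ℝ (Fin n))

/-- `f` is a hyperspherical harmonic of degree `ℓ` on `S^d`: a smooth solution of
`Δ f = -ℓ (ℓ + d - 1) f`. -/
def IsHarmonic (d ℓ : ℕ) (f : USphere (d + 1) → ℝ) : Prop :=
  ContMDiff (𝓡 d) 𝓘(ℝ, ℝ) ∞ f ∧
    ∀ x, laplaceBeltrami f x = -((ℓ : ℝ) * ((ℓ : ℝ) + (d : ℝ) - 1)) * f x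

/-- `Y 0, …, Y (N - 1)` is an orthonormal basis, for the inner product of `L²(S^d)` with respect
to the normalized measure, of the space of hyperspherical harmonics of degree `ℓ`. -/
structure IsHarmonicBasis (d ℓ : ℕ) {N : ℕ} (Y : Fin N → USphere (d + 1) → ℝ) : Prop where
  harmonic : ∀ m, IsHarmonic d ℓ (Y m)
  orthonormal : ∀ m m', ∫ x, Y m x * Y m' x ∂(unif (d + 1)) = if m = m' then 1 else 0
  spans : ∀ f, IsHarmonic d ℓ f → ∃ c : Fin N → ℝ, ∀ x, f x = ∑ m, c m * Y m x

/-- The dimension `(2ℓ + d - 1) / ℓ * binom (ℓ + d - 2) (ℓ - 1)` (which is `1` for `ℓ = 0`)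
of the space of hyperspherical harmonics of degree `ℓ` on `S^d`, for `d ≥ 2`. -/
def harmonicDim (d ℓ : ℕ) : ℝ :=
  if ℓ = 0 then 1 else
    (2 * (ℓ : ℝ) + (d : ℝ) - 1) / (ℓ : ℝ) * ((ℓ + d - 2).choose (ℓ - 1) : ℝ)

/-- The eigenfunction `h_α = ∑ m, α_m Y_m` with coefficient vector `α` in the unit sphere. -/
def eigenfun {d N : ℕ} (Y : Fin N → USphere (d + 1) → ℝ) (α : USphere N)
    (x : USphere (d + 1)) : ℝ :=
  ∑ m, (α : EuclideanSpace ℝ (Fin N)) m * Y m x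

/-- The Kolmogorov distance of two probability measures on `ℝ`: the supremum distance of their
distribution functions. -/
def kolDist (P Q : Measure ℝ) : ℝ :=
  ⨆ u : ℝ, |P.real (Set.Iic u) - Q.real (Set.Iic u)|

/-- `d_Kol (h(X), Z)` for `X` uniformly distributed on `S^d` and `Z` standard Gaussian. -/
def kolToGaussian {d : ℕ} (h : USphere (d + 1) → ℝ) : ℝ :=
  kolDist ((unif (d + 1)).map h) (gaussianReal 0 1)

end SphericalHarmonics

end

/-!
A uniform coefficient vector `α` on the sphere of `ℝ^N` is the direction of a standard Gaussian
vector `G`, whose norm is close to `√N`, so `h_α` may be replaced by `x ↦ ⟨e x, G⟩` with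
`e x = (Y_1 x, …, Y_N x) / √N`.

Two facts about the basis are used. Rotations act on the span of `Y` by orthogonal matrices, so
`∑ m, Y_m ^ 2` is constant, i.e. `e x` is a unit vector (`IsHarmonicBasis.sum_sq`); and for `ℓ ≥ 1`
the `Y_m` have mean zero, because the harmonic that represents the form `f ↦ ∫ f` is rotation
invariant, hence constant, hence zero (`IsHarmonicBasis.integral_eq_zero`). Therefore the
correlation `ρ(x, y) = ⟨e x, e y⟩` has `∫∫ ρ = 0` and `∫∫ ρ ^ 2 = 1 / N`.

For fixed `x`, the variable `⟨e x, G⟩` is standard Gaussian, so the random distribution function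
`F_G(u)` of `x ↦ ⟨e x, G⟩` has mean `Φ(u)`, and its variance is the double integral of the covariance
of the events `⟨e x, G⟩ ≤ u` and `⟨e y, G⟩ ≤ u`. This covariance is a multiple of `ρ`, plus an error
of size `O(ρ ^ 2 (1 + u ^ 2))` (`abs_jointCDF_sub_le`): the linear term integrates to zero and the
error to `O((1 + u ^ 2) / N)`. Hence the Cramér–von Mises distance `∫ (F_G - Φ) ^ 2 dΦ` has mean
`O(1 / N)`. If `|F_G - Φ|` exceeds `η` somewhere, then by monotonicity the Cramér–von Mises distance
is at least `η ^ 3 / 8` (`cube_le_integral_sq`), and Markov's inequality gives the factor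
`1 / (N ε ^ 3)`. The error from normalizing `G` is controlled by Chebyshev's inequality
(`stdGaussian_abs_norm_div_sub_one_ge`).

Finally `N` is at least `harmonicDim d ℓ`, since the harmonic homogeneous polynomials of degree `ℓ`
embed into the span of `Y` and the Laplacian maps degree `ℓ` to degree `ℓ - 2`
(`IsHarmonicBasis.harmonicDim_le`). The two asymptotic statements are elementary lower bounds for the
binomial coefficient in `harmonicDim`.
-/

open scoped Pointwise

noncomputable section

namespace SphericalHarmonics

/-! ### The dimension of the space of harmonic polynomials -/

section

theorem harmonicDim_succ (d k : ℕ) (hd : 2 ≤ d) :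
    harmonicDim d (k + 1) = (2 * (k : ℝ) + d + 1) / (k + 1) * ((k + d - 1).choose k : ℝ) := by
  have h : k + 1 + d - 2 = k + d - 1 := by omega
  simp only [harmonicDim, Nat.succ_ne_zero, if_false, h, Nat.add_sub_cancel]
  push_cast
  ring

theorem harmonicDim_pos (d ℓ : ℕ) (hd : 2 ≤ d) : 0 < harmonicDim d ℓ := by
  rcases ℓ with _ | k
  · simp [harmonicDim]
  · rw [harmonicDim_succ d k hd]
    have : 0 < (k + d - 1).choose k := Nat.choose_pos (by omega)
    positivity

theorem pow_le_harmonicDim_degree (d ℓ : ℕ) (hd : 2 ≤ d) (hℓ : 1 ≤ ℓ) :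
    (ℓ : ℝ) ^ (d - 1) / ((d - 1).factorial : ℝ) ≤ harmonicDim d ℓ := by
  obtain ⟨k, rfl⟩ : ∃ k, ℓ = k + 1 := ⟨ℓ - 1, by omega⟩
  rw [harmonicDim_succ d k hd]
  have h1 := Nat.pow_le_choose (α := ℝ) (d - 1) (k + d - 1)
  have h2 : k + d - 1 + 1 - (d - 1) = k + 1 := by omega
  have h3 : (k + d - 1).choose (d - 1) = (k + d - 1).choose k := by
    rw [← Nat.choose_symm (by omega)]
    congr 1
    omega
  rw [h2, h3] at h1
  refine h1.trans (le_mul_of_one_le_left (by positivity) ?_)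
  rw [le_div_iff₀ (by positivity)]
  have : (0 : ℝ) ≤ d := by positivity
  linarith [(by positivity : (0 : ℝ) ≤ k)]

theorem pow_le_harmonicDim_dim (d ℓ : ℕ) (hd : 2 ≤ d) :
    (d : ℝ) ^ ℓ / (ℓ.factorial : ℝ) ≤ harmonicDim d ℓ := by
  rcases ℓ with _ | k
  · simp [harmonicDim]
  rw [harmonicDim_succ d k hd]
  have h1 := Nat.pow_le_choose (α := ℝ) k (k + d - 1)
  have h2 : k + d - 1 + 1 - k = d := by omega
  rw [h2] at h1
  have h3 : (d : ℝ) ^ (k + 1) / ((k + 1).factorial : ℝ)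
      = (d : ℝ) / (k + 1) * ((d : ℝ) ^ k / (k.factorial : ℝ)) := by
    rw [Nat.factorial_succ, pow_succ]
    push_cast
    field_simp
  rw [h3]
  refine mul_le_mul ?_ h1 (by positivity) (by positivity)
  gcongr
  linarith [(by positivity : (0 : ℝ) ≤ k)]

theorem isBigO_of_pow_le {K : ℝ} (hK : 0 < K) {c : ℝ} (hc : 0 < c) (D P : ℕ → ℝ)
    (ε : ℕ → ℝ) (hε : ∀ n, 0 < ε n) (hP : ∀ᶠ n in atTop, 0 < P n)
    (h : ∀ᶠ n in atTop, c * P n ≤ D n) :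
    (fun n => K / (D n * ε n ^ 3)) =O[atTop] (fun n => 1 / (P n * ε n ^ 3)) := by
  refine IsBigO.of_bound (K / c) ?_
  filter_upwards [hP, h] with n h1 h2
  have h3 : 0 < ε n ^ 3 := pow_pos (hε n) 3
  have h4 : 0 < D n := lt_of_lt_of_le (by positivity) h2
  rw [Real.norm_of_nonneg (by positivity), Real.norm_of_nonneg (by positivity),
    div_mul_div_comm, mul_one]
  apply div_le_div_of_nonneg_left hK.le (by positivity)
  nlinarith [mul_le_mul_of_nonneg_right h2 h3.le]

open MvPolynomial

instance finite_homogeneousSubmodule (σ : Type*) [Finite σ] (n : ℕ) :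
    Module.Finite ℝ (homogeneousSubmodule σ ℝ n) :=
  Module.Finite.iff_fg.mpr (homogeneousSubmodule_fg σ ℝ n)

theorem finrank_homogeneousSubmodule (d n : ℕ) :
    Module.finrank ℝ (homogeneousSubmodule (Fin (d + 1)) ℝ n) = (n + d).choose d := by
  rw [homogeneousSubmodule_eq_finsupp_supported]
  have : {f : Fin (d + 1) →₀ ℕ | f.degree = n} =
      ((Finset.univ : Finset (Fin (d + 1))).finsuppAntidiag n : Set (Fin (d + 1) →₀ ℕ)) := by
    ext f
    simp [Finsupp.degree_eq_sum]
  rw [this, (AddMonoidAlgebra.supportedEquivFinsupp (R := ℝ) (S := ℝ) _).finrank_eq,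
    Module.finrank_finsupp_self, ← Nat.card_eq_fintype_card, Nat.card_coe_set_eq,
    Set.ncard_coe_finset, Finset.card_finsuppAntidiag_nat_eq_choose]
  simp only [Finset.card_univ, Fintype.card_fin]
  have h : d + 1 + n - 1 = n + d := by omega
  rw [h, ← Nat.choose_symm (by omega)]
  congr 1
  omega

/-- The Laplacian `∑ i, ∂ᵢ²` on polynomials. -/
def polyLaplacian (σ : Type*) [Fintype σ] : MvPolynomial σ ℝ →ₗ[ℝ] MvPolynomial σ ℝ :=
  ∑ i, (pderiv i).toLinearMap ∘ₗ (pderiv i).toLinearMap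

theorem polyLaplacian_apply {σ : Type*} [Fintype σ] (p : MvPolynomial σ ℝ) :
    polyLaplacian σ p = ∑ i, pderiv i (pderiv i p) := by
  simp [polyLaplacian, LinearMap.sum_apply]

/-- The space of harmonic homogeneous polynomials of degree `n`. -/
def harmonicPoly (σ : Type*) [Fintype σ] (n : ℕ) : Submodule ℝ (MvPolynomial σ ℝ) :=
  homogeneousSubmodule σ ℝ n ⊓ LinearMap.ker (polyLaplacian σ)

instance finite_harmonicPoly (σ : Type*) [Fintype σ] (n : ℕ) :
    Module.Finite ℝ (harmonicPoly σ n) :=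
  Submodule.finiteDimensional_of_le (S₂ := homogeneousSubmodule σ ℝ n) inf_le_left

/-- Rank-nullity for the Laplacian on homogeneous polynomials of degree `n`. -/
theorem finrank_le_finrank_harmonicPoly_add {σ : Type*} [Fintype σ] (n : ℕ)
    (W : Submodule ℝ (MvPolynomial σ ℝ)) [Module.Finite ℝ W]
    (hW : ∀ p : MvPolynomial σ ℝ, p.IsHomogeneous n → polyLaplacian σ p ∈ W) :
    Module.finrank ℝ (homogeneousSubmodule σ ℝ n) ≤
      Module.finrank ℝ (harmonicPoly σ n) + Module.finrank ℝ W := by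
  set L := (polyLaplacian σ).domRestrict (homogeneousSubmodule σ ℝ n) with hL
  have h1 := LinearMap.finrank_range_add_finrank_ker L
  have h2 : Module.finrank ℝ (LinearMap.range L) ≤ Module.finrank ℝ W := by
    apply Submodule.finrank_mono
    rintro _ ⟨p, rfl⟩
    exact hW p.1 p.2
  have h3 : Module.finrank ℝ (LinearMap.ker L) = Module.finrank ℝ (harmonicPoly σ n) := by
    have : harmonicPoly σ n = (LinearMap.ker L).map (homogeneousSubmodule σ ℝ n).subtype := by
      ext p
      simp [harmonicPoly, hL, LinearMap.domRestrict_apply, and_comm]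
    rw [this]
    exact ((LinearMap.ker L).equivMapOfInjective _ (Submodule.injective_subtype _)).finrank_eq
  omega

theorem isHomogeneous_polyLaplacian {σ : Type*} [Fintype σ] {n : ℕ} {p : MvPolynomial σ ℝ}
    (hp : p.IsHomogeneous n) : (polyLaplacian σ p).IsHomogeneous (n - 2) := by
  rw [polyLaplacian_apply]
  exact IsHomogeneous.sum _ _ _ fun i _ => hp.pderiv.pderiv

theorem polyLaplacian_eq_zero {σ : Type*} [Fintype σ] {p : MvPolynomial σ ℝ}
    (hp : p.IsHomogeneous 1) : polyLaplacian σ p = 0 := by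
  rw [polyLaplacian_apply]
  refine Finset.sum_eq_zero fun i _ => ?_
  have h : (pderiv i p).IsHomogeneous 0 := hp.pderiv
  rw [totalDegree_eq_zero_iff_eq_C.mp ((totalDegree_zero_iff_isHomogeneous _).mpr h), pderiv_C]

/-- `harmonicDim` is the difference of the dimensions of the spaces of homogeneous polynomials of
degrees `ℓ` and `ℓ - 2` in `d + 1` variables. -/
theorem choose_eq_add_harmonicDim (k e : ℕ) :
    ((k + 2 + (e + 2)).choose (e + 2) : ℝ) = harmonicDim (e + 2) (k + 2)
      + ((k + (e + 2)).choose (e + 2) : ℝ) := by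
  rw [harmonicDim_succ (e + 2) (k + 1) (by omega)]
  have h1 : k + 1 + (e + 2) - 1 = (k + 1) + (e + 1) := by omega
  have h2 : ((k + 1) + (e + 1)).choose (k + 1) = ((k + 1) + (e + 1)).choose (e + 1) := by
    rw [← Nat.choose_symm (by omega)]; congr 1; omega
  rw [h1, h2, Nat.add_choose, Nat.add_choose, Nat.add_choose,
    Nat.cast_div (Nat.factorial_mul_factorial_dvd_factorial_add _ _) (by positivity),
    Nat.cast_div (Nat.factorial_mul_factorial_dvd_factorial_add _ _) (by positivity),
    Nat.cast_div (Nat.factorial_mul_factorial_dvd_factorial_add _ _) (by positivity)]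
  have e1 : k + 2 + (e + 2) = (k + e + 2) + 1 + 1 := by ring
  have e2 : k + (e + 2) = k + e + 2 := by ring
  have e3 : k + 1 + (e + 1) = k + e + 2 := by ring
  rw [e1, e2, e3, Nat.factorial_succ (k + e + 2 + 1), Nat.factorial_succ (k + e + 2),
    Nat.factorial_succ (k + 1), Nat.factorial_succ k, Nat.factorial_succ (e + 1)]
  push_cast
  field_simp
  ring

theorem harmonicDim_le_finrank_harmonicPoly (d ℓ : ℕ) (hd : 2 ≤ d) (hℓ : 1 ≤ ℓ) :
    harmonicDim d ℓ ≤ Module.finrank ℝ (harmonicPoly (Fin (d + 1)) ℓ) := by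
  obtain rfl | hℓ := hℓ.eq_or_lt
  · have h := finrank_le_finrank_harmonicPoly_add (σ := Fin (d + 1)) 1 ⊥
      fun p hp => by simp [polyLaplacian_eq_zero hp]
    rw [finrank_homogeneousSubmodule, finrank_bot, add_comm 1 d, Nat.choose_succ_self_right] at h
    rw [harmonicDim_succ d 0 hd]
    simp only [Nat.choose_zero_right]
    have : ((d + 1 : ℕ) : ℝ) ≤ Module.finrank ℝ (harmonicPoly (Fin (d + 1)) 1) := by
      exact_mod_cast h
    push_cast at this ⊢
    simpa using this
  · obtain ⟨k, rfl⟩ : ∃ k, ℓ = k + 2 := ⟨ℓ - 2, by omega⟩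
    obtain ⟨e, rfl⟩ : ∃ e, d = e + 2 := ⟨d - 2, by omega⟩
    have h := finrank_le_finrank_harmonicPoly_add (σ := Fin (e + 2 + 1)) (k + 2)
      (homogeneousSubmodule _ ℝ k) fun p hp => isHomogeneous_polyLaplacian hp
    rw [finrank_homogeneousSubmodule, finrank_homogeneousSubmodule] at h
    have h' : ((k + 2 + (e + 2)).choose (e + 2) : ℝ) ≤
        Module.finrank ℝ (harmonicPoly (Fin (e + 2 + 1)) (k + 2))
          + ((k + (e + 2)).choose (e + 2) : ℝ) := by exact_mod_cast h
    rw [choose_eq_add_harmonicDim] at h'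
    linarith

end

/-! ### Rotations and the Laplace-Beltrami operator -/

section

section Rotation

variable {n : ℕ}

/-- The action of a linear isometry of `ℝ^n` on the unit sphere. -/
def rot (R : EuclideanSpace ℝ (Fin n) ≃ₗᵢ[ℝ] EuclideanSpace ℝ (Fin n)) (x : USphere n) :
    USphere n :=
  ⟨R x, by simp⟩

@[simp]
theorem coe_rot (R : EuclideanSpace ℝ (Fin n) ≃ₗᵢ[ℝ] EuclideanSpace ℝ (Fin n)) (x : USphere n) :
    (rot R x : EuclideanSpace ℝ (Fin n)) = R x := rfl

theorem continuous_rot (R : EuclideanSpace ℝ (Fin n) ≃ₗᵢ[ℝ] EuclideanSpace ℝ (Fin n)) :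
    Continuous (rot R) :=
  (R.continuous.comp continuous_subtype_val).subtype_mk _

theorem exists_rot_eq (x y : USphere n) : ∃ R, rot R x = y := by
  refine ⟨(ℝ ∙ ((x : EuclideanSpace ℝ (Fin n)) - y))ᗮ.reflection, Subtype.ext ?_⟩
  exact Submodule.reflection_sub (by simp)

theorem map_rot_unif (R : EuclideanSpace ℝ (Fin n) ≃ₗᵢ[ℝ] EuclideanSpace ℝ (Fin n)) :
    (unif n).map (rot R) = unif n := by
  rw [unif, Measure.map_smul]
  congr 1
  ext s hs
  have hm := (continuous_rot R).measurable
  rw [Measure.map_apply hm hs, Measure.toSphere_apply' _ hs, Measure.toSphere_apply' _ (hm hs)]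
  congr 1
  have h : Set.Ioo (0 : ℝ) 1 • ((↑) '' (rot R ⁻¹' s) : Set (EuclideanSpace ℝ (Fin n)))
      = R ⁻¹' (Set.Ioo (0 : ℝ) 1 • ((↑) '' s)) := by
    ext y
    simp only [Set.mem_smul, Set.mem_image, Set.mem_preimage]
    constructor
    · rintro ⟨c, hc, _, ⟨x, hx, rfl⟩, rfl⟩
      exact ⟨c, hc, R x, ⟨rot R x, hx, rfl⟩, by simp⟩
    · rintro ⟨c, hc, _, ⟨x, hx, rfl⟩, h⟩
      refine ⟨c, hc, R.symm x, ⟨rot R.symm x, ?_, rfl⟩, ?_⟩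
      · convert hx
        exact Subtype.ext (by simp)
      · rw [← map_smul, h, R.symm_apply_apply]
  rw [h]
  exact R.measurePreserving.measure_preimage_equiv (f := R.toHomeomorph.toMeasurableEquiv) _

instance isProbabilityMeasure_unif [NeZero n] : IsProbabilityMeasure (unif n) := by
  constructor
  rw [unif, Measure.smul_apply, smul_eq_mul]
  apply ENNReal.inv_mul_cancel
  · have : Nontrivial (EuclideanSpace ℝ (Fin n)) :=
      Module.nontrivial_of_finrank_pos (R := ℝ) (by simp [Nat.pos_of_ne_zero (NeZero.ne n)])
    rw [Ne, Measure.measure_univ_eq_zero]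
    exact Measure.toSphere_ne_zero _
  · exact measure_ne_top _ _

theorem integral_comp_rot (R : EuclideanSpace ℝ (Fin n) ≃ₗᵢ[ℝ] EuclideanSpace ℝ (Fin n))
    {f : USphere n → ℝ} (hf : Continuous f) :
    ∫ x, f (rot R x) ∂(unif n) = ∫ x, f x ∂(unif n) := by
  conv_rhs => rw [← map_rot_unif R]
  rw [integral_map (continuous_rot R).measurable.aemeasurable hf.aestronglyMeasurable]

end Rotation

section Laplace

variable {n : ℕ}

theorem radialExt_of_ne {f : USphere n → ℝ} {x : EuclideanSpace ℝ (Fin n)} (hx : x ≠ 0)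
    (h : ‖x‖⁻¹ • x ∈ Metric.sphere (0 : EuclideanSpace ℝ (Fin n)) 1) :
    radialExt f x = f ⟨‖x‖⁻¹ • x, h⟩ := by
  simp [radialExt, hx]

theorem norm_inv_smul_mem_sphere {x : EuclideanSpace ℝ (Fin n)} (hx : x ≠ 0) :
    ‖x‖⁻¹ • x ∈ Metric.sphere (0 : EuclideanSpace ℝ (Fin n)) 1 := by
  rw [mem_sphere_zero_iff_norm, norm_smul, norm_inv, norm_norm,
    inv_mul_cancel₀ (norm_ne_zero_iff.mpr hx)]

theorem radialExt_comp_rot (R : EuclideanSpace ℝ (Fin n) ≃ₗᵢ[ℝ] EuclideanSpace ℝ (Fin n))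
    (f : USphere n → ℝ) : radialExt (f ∘ rot R) = radialExt f ∘ R := by
  ext x
  by_cases hx : x = 0
  · simp [radialExt, hx]
  · have hRx : R x ≠ 0 := by simpa using hx
    rw [Function.comp_apply, radialExt_of_ne hx (norm_inv_smul_mem_sphere hx),
      radialExt_of_ne hRx (norm_inv_smul_mem_sphere hRx), Function.comp_apply]
    congr 1
    exact Subtype.ext (by simp)

theorem laplacian_comp_linearIsometryEquiv {E : Type*} [NormedAddCommGroup E]
    [InnerProductSpace ℝ E] [FiniteDimensional ℝ E] (R : E ≃ₗᵢ[ℝ] E) (F : E → ℝ) (x : E) :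
    Laplacian.laplacian (F ∘ R) x = Laplacian.laplacian F (R x) := by
  rw [InnerProductSpace.laplacian_eq_iteratedFDeriv_orthonormalBasis _ (stdOrthonormalBasis ℝ E),
    InnerProductSpace.laplacian_eq_iteratedFDeriv_orthonormalBasis F
      ((stdOrthonormalBasis ℝ E).map R)]
  refine Finset.sum_congr rfl fun i _ => ?_
  have h := R.toContinuousLinearEquiv.iteratedFDerivWithin_comp_right (x := x) F
    uniqueDiffOn_univ (Set.mem_univ _) 2
  simp only [Set.preimage_univ, iteratedFDerivWithin_univ] at h
  change iteratedFDeriv ℝ 2 (F ∘ R.toContinuousLinearEquiv) x _ = _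
  rw [h, ContinuousMultilinearMap.compContinuousLinearMap_apply]
  congr 1
  ext j
  fin_cases j <;> simp

theorem laplaceBeltrami_comp_rot
    (R : EuclideanSpace ℝ (Fin n) ≃ₗᵢ[ℝ] EuclideanSpace ℝ (Fin n)) (f : USphere n → ℝ)
    (x : USphere n) : laplaceBeltrami (f ∘ rot R) x = laplaceBeltrami f (rot R x) := by
  rw [laplaceBeltrami, radialExt_comp_rot, laplacian_comp_linearIsometryEquiv]
  rfl

theorem laplaceBeltrami_const (c : ℝ) (x : USphere n) :
    laplaceBeltrami (fun _ => c) x = 0 := by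
  have hx : (x : EuclideanSpace ℝ (Fin n)) ≠ 0 := ne_zero_of_mem_unit_sphere x
  have h : radialExt (fun _ : USphere n => c) =ᶠ[nhds (x : EuclideanSpace ℝ (Fin n))]
      fun _ => c := by
    filter_upwards [isOpen_ne.mem_nhds hx] with y hy
    rw [radialExt_of_ne hy (norm_inv_smul_mem_sphere hy)]
  rw [laplaceBeltrami, (InnerProductSpace.laplacian_congr_nhds h).eq_of_nhds]
  exact congrFun InnerProductSpace.laplacian_const _

end Laplace

section Smooth

variable {d : ℕ}

theorem fact_finrank_euclideanSpace (n : ℕ) :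
    Fact (Module.finrank ℝ (EuclideanSpace ℝ (Fin n)) = n) :=
  ⟨finrank_euclideanSpace_fin⟩

attribute [local instance] fact_finrank_euclideanSpace

theorem contMDiff_rot
    (R : EuclideanSpace ℝ (Fin (d + 1)) ≃ₗᵢ[ℝ] EuclideanSpace ℝ (Fin (d + 1))) :
    ContMDiff (𝓡 d) (𝓡 d) ∞ (rot R) := by
  have h : ContMDiff (𝓡 d) 𝓘(ℝ, EuclideanSpace ℝ (Fin (d + 1))) ∞
      fun x : USphere (d + 1) => R (x : EuclideanSpace ℝ (Fin (d + 1))) :=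
    R.contDiff.contMDiff.comp contMDiff_coe_sphere
  exact h.codRestrict_sphere fun x => (rot R x).2

/-- The radial extension is the composite of `f` with the smooth retraction `x ↦ x / ‖x‖`. -/
theorem contDiffAt_radialExt {f : USphere (d + 1) → ℝ} (hf : ContMDiff (𝓡 d) 𝓘(ℝ, ℝ) ∞ f)
    {x : EuclideanSpace ℝ (Fin (d + 1))} (hx : x ≠ 0) : ContDiffAt ℝ ∞ (radialExt f) x := by
  let U : TopologicalSpace.Opens (EuclideanSpace ℝ (Fin (d + 1))) := ⟨{0}ᶜ, isOpen_compl_singleton⟩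
  have hg : ContMDiff 𝓘(ℝ, EuclideanSpace ℝ (Fin (d + 1)))
      𝓘(ℝ, EuclideanSpace ℝ (Fin (d + 1))) ∞
      (fun y : U => ‖(y : EuclideanSpace ℝ (Fin (d + 1)))‖⁻¹ •
        (y : EuclideanSpace ℝ (Fin (d + 1)))) := by
    intro y
    have hy : (y : EuclideanSpace ℝ (Fin (d + 1))) ≠ 0 := y.2
    refine (contMDiffAt_subtype_iff (x := y)
      (f := fun y : EuclideanSpace ℝ (Fin (d + 1)) => ‖y‖⁻¹ • y)).mpr ?_
    apply ContDiffAt.contMDiffAt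
    exact ((contDiffAt_norm ℝ hy).inv (norm_ne_zero_iff.mpr hy)).smul contDiffAt_id
  have h := hf.comp (hg.codRestrict_sphere fun y => norm_inv_smul_mem_sphere y.2)
  rw [← contMDiffAt_iff_contDiffAt]
  refine (contMDiffAt_subtype_iff (U := U) (x := ⟨x, hx⟩) (f := radialExt f)).mp ?_
  refine (h ⟨x, hx⟩).congr_of_eventuallyEq (Eventually.of_forall fun y => ?_)
  exact radialExt_of_ne y.2 (norm_inv_smul_mem_sphere y.2)

variable {ℓ : ℕ}

theorem IsHarmonic.continuous {f : USphere (d + 1) → ℝ} (hf : IsHarmonic d ℓ f) : Continuous f :=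
  hf.1.continuous

theorem IsHarmonic.comp_rot {f : USphere (d + 1) → ℝ} (hf : IsHarmonic d ℓ f)
    (R : EuclideanSpace ℝ (Fin (d + 1)) ≃ₗᵢ[ℝ] EuclideanSpace ℝ (Fin (d + 1))) :
    IsHarmonic d ℓ (f ∘ rot R) :=
  ⟨hf.1.comp (contMDiff_rot R), fun x => by rw [laplaceBeltrami_comp_rot, hf.2]; rfl⟩

theorem radialExt_add (f g : USphere (d + 1) → ℝ) :
    radialExt (f + g) = radialExt f + radialExt g := by
  ext x
  by_cases hx : x = 0 <;> simp [radialExt, hx]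

theorem radialExt_smul (c : ℝ) (f : USphere (d + 1) → ℝ) :
    radialExt (c • f) = c • radialExt f := by
  ext x
  by_cases hx : x = 0 <;> simp [radialExt, hx]

theorem IsHarmonic.add {f g : USphere (d + 1) → ℝ} (hf : IsHarmonic d ℓ f)
    (hg : IsHarmonic d ℓ g) : IsHarmonic d ℓ (f + g) := by
  refine ⟨hf.1.add hg.1, fun x => ?_⟩
  have hx : (x : EuclideanSpace ℝ (Fin (d + 1))) ≠ 0 := ne_zero_of_mem_unit_sphere x
  have h2 : (2 : ℕ∞ω) ≤ ∞ := WithTop.coe_le_coe.mpr le_top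
  rw [laplaceBeltrami, radialExt_add,
    ((contDiffAt_radialExt hf.1 hx).of_le h2).laplacian_add
      ((contDiffAt_radialExt hg.1 hx).of_le h2)]
  have h3 := hf.2 x
  have h4 := hg.2 x
  rw [laplaceBeltrami] at h3 h4
  rw [h3, h4, Pi.add_apply]
  ring

theorem IsHarmonic.const_smul {f : USphere (d + 1) → ℝ} (hf : IsHarmonic d ℓ f) (c : ℝ) :
    IsHarmonic d ℓ (c • f) := by
  refine ⟨(c • ContinuousLinearMap.id ℝ ℝ).contDiff.contMDiff.comp hf.1, fun x => ?_⟩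
  have hx : (x : EuclideanSpace ℝ (Fin (d + 1))) ≠ 0 := ne_zero_of_mem_unit_sphere x
  have h2 : (2 : ℕ∞ω) ≤ ∞ := WithTop.coe_le_coe.mpr le_top
  rw [laplaceBeltrami, radialExt_smul,
    InnerProductSpace.laplacian_smul c ((contDiffAt_radialExt hf.1 hx).of_le h2)]
  have h3 := hf.2 x
  rw [laplaceBeltrami] at h3
  rw [h3, Pi.smul_apply, smul_eq_mul, smul_eq_mul]
  ring

theorem IsHarmonic.zero : IsHarmonic d ℓ (0 : USphere (d + 1) → ℝ) :=
  ⟨contMDiff_const, fun x => (laplaceBeltrami_const 0 x).trans (by simp)⟩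

theorem IsHarmonic.sum {ι : Type*} (s : Finset ι) (f : ι → USphere (d + 1) → ℝ)
    (hf : ∀ i, IsHarmonic d ℓ (f i)) : IsHarmonic d ℓ (∑ i ∈ s, f i) :=
  Finset.sum_induction f (IsHarmonic d ℓ) (fun _ _ => IsHarmonic.add) IsHarmonic.zero
    fun i _ => hf i

theorem IsHarmonic.eq_zero_of_const {f : USphere (d + 1) → ℝ} (hf : IsHarmonic d ℓ f)
    (hd : 2 ≤ d) (hℓ : 1 ≤ ℓ) (c : ℝ) (hc : ∀ x, f x = c) (x : USphere (d + 1)) : f x = 0 := by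
  have h := hf.2 x
  obtain rfl : f = fun _ => c := funext hc
  rw [laplaceBeltrami_const] at h
  have h1 : (1 : ℝ) ≤ ℓ := by exact_mod_cast hℓ
  have h2 : (2 : ℝ) ≤ d := by exact_mod_cast hd
  have h3 : (ℓ : ℝ) * ((ℓ : ℝ) + d - 1) ≠ 0 := by
    have : 0 < (ℓ : ℝ) + d - 1 := by linarith
    positivity
  have h4 : -((ℓ : ℝ) * ((ℓ : ℝ) + d - 1)) * c = 0 := h.symm
  simpa [h3] using h4

end Smooth

end

/-! ### Restrictions of harmonic polynomials to the sphere -/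

section

open MvPolynomial

section Polynomial

variable {σ : Type*}

/-- The polynomial function on `ℝ^σ` defined by `p`. -/
def polyFun (p : MvPolynomial σ ℝ) (x : EuclideanSpace ℝ σ) : ℝ := eval (fun i => x i) p

theorem contDiff_polyFun [Fintype σ] (p : MvPolynomial σ ℝ) : ContDiff ℝ ∞ (polyFun p) := by
  unfold polyFun
  induction p using MvPolynomial.induction_on with
  | C a => simpa using contDiff_const
  | add p q hp hq => simpa using hp.add hq
  | mul_X p i hp =>
    simp only [map_mul, eval_X]
    exact hp.mul (by fun_prop)

theorem polyFun_smul [Fintype σ] {n : ℕ} {p : MvPolynomial σ ℝ} (hp : p.IsHomogeneous n)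
    (c : ℝ) (x : EuclideanSpace ℝ σ) : polyFun p (c • x) = c ^ n * polyFun p x := by
  simp only [polyFun, eval_eq', Finset.mul_sum]
  refine Finset.sum_congr rfl fun m hm => ?_
  have h : m.degree = n := by
    by_contra h
    exact (MvPolynomial.mem_support_iff.mp hm) (hp.coeff_eq_zero h)
  rw [← h, Finsupp.degree_eq_sum, ← Finset.prod_pow_eq_pow_sum]
  simp only [PiLp.smul_apply, smul_eq_mul, mul_pow, Finset.prod_mul_distrib]
  ring

theorem hasDerivAt_polyFun_line [DecidableEq σ] (p : MvPolynomial σ ℝ) (x : EuclideanSpace ℝ σ)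
    (i : σ) (t : ℝ) :
    HasDerivAt (fun t : ℝ => polyFun p (x + t • EuclideanSpace.single i 1))
      (polyFun (pderiv i p) (x + t • EuclideanSpace.single i 1)) t := by
  unfold polyFun
  induction p using MvPolynomial.induction_on with
  | C a => simpa using hasDerivAt_const t a
  | add p q hp hq =>
    simp only [map_add]
    exact hp.add hq
  | mul_X p j hp =>
    have hj : HasDerivAt (fun t : ℝ => (x + t • EuclideanSpace.single i (1 : ℝ)) j)
        (Pi.single (M := fun _ => ℝ) i 1 j) t := by
      have h1 : HasDerivAt (fun t : ℝ => x j + t * Pi.single (M := fun _ => ℝ) i 1 j)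
          (Pi.single (M := fun _ => ℝ) i 1 j) t := by
        simpa using ((hasDerivAt_id t).mul_const (Pi.single (M := fun _ => ℝ) i 1 j)).const_add (x j)
      simpa [Pi.single_apply] using h1
    have h := hp.mul hj
    simp only [map_mul, eval_X, pderiv_mul, map_add, pderiv_X]
    refine HasDerivAt.congr_deriv h ?_
    by_cases hij : j = i
    · subst hij; simp
    · simp [Pi.single_eq_of_ne hij]

theorem sum_mul_polyFun_pderiv [Fintype σ] {n : ℕ} {p : MvPolynomial σ ℝ} (hp : p.IsHomogeneous n)
    (x : EuclideanSpace ℝ σ) : ∑ i, x i * polyFun (pderiv i p) x = n * polyFun p x := by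
  have h := congrArg (eval fun i => x i) hp.sum_X_mul_pderiv
  simpa [polyFun] using h

theorem sum_polyFun_pderiv_pderiv [Fintype σ] {p : MvPolynomial σ ℝ} (hp : polyLaplacian σ p = 0)
    (x : EuclideanSpace ℝ σ) : ∑ i, polyFun (pderiv i (pderiv i p)) x = 0 := by
  rw [polyLaplacian_apply] at hp
  have h := congrArg (eval fun i => x i) hp
  simpa [polyFun] using h

end Polynomial

/-- Pure second derivatives are second derivatives along lines. -/
theorem iteratedFDeriv_two_diag {E : Type*} [NormedAddCommGroup E] [NormedSpace ℝ E]
    {F : E → ℝ} {x : E} (hF : ContDiffAt ℝ 2 F x) (v : E) {g : ℝ → ℝ} {a : ℝ}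
    (hg : ∀ᶠ t in nhds (0 : ℝ), HasDerivAt (fun t : ℝ => F (x + t • v)) (g t) t)
    (ha : HasDerivAt g a 0) : iteratedFDeriv ℝ 2 F x ![v, v] = a := by
  rw [iteratedFDeriv_two_apply]
  simp only [Matrix.cons_val_zero, Matrix.cons_val_one]
  have hline : ∀ t : ℝ, HasDerivAt (fun t : ℝ => x + t • v) v t := fun t => by
    simpa using ((hasDerivAt_id t).smul_const v).const_add x
  have hcont : Tendsto (fun t : ℝ => x + t • v) (nhds 0) (nhds x) := by
    have := (hline 0).continuousAt.tendsto
    simpa using this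
  have h1 : ∀ᶠ y in nhds x, DifferentiableAt ℝ F y :=
    (hF.eventually (by simp)).mono fun y hy => hy.differentiableAt (by norm_num)
  have h2 : g =ᶠ[nhds 0] fun t => fderiv ℝ F (x + t • v) v := by
    filter_upwards [hg, hcont.eventually h1] with t ht hd
    exact ht.unique (hd.hasFDerivAt.comp_hasDerivAt t (hline t))
  have h3 : DifferentiableAt ℝ (fderiv ℝ F) x :=
    (hF.fderiv_right (m := 1) (by norm_num)).differentiableAt (by norm_num)
  have h4 : HasFDerivAt (fderiv ℝ F) (fderiv ℝ (fderiv ℝ F) x) (x + (0 : ℝ) • v) := by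
    simpa using h3.hasFDerivAt
  have h5 : HasDerivAt (fun t : ℝ => fderiv ℝ F (x + t • v)) (fderiv ℝ (fderiv ℝ F) x v) 0 :=
    h4.comp_hasDerivAt 0 (hline 0)
  have h6 : HasDerivAt (fun t : ℝ => fderiv ℝ F (x + t • v) v)
      (fderiv ℝ (fderiv ℝ F) x v v) 0 := by
    simpa using h5.clm_apply (hasDerivAt_const (0 : ℝ) v)
  exact (h6.congr_of_eventuallyEq h2).unique ha

variable {d ℓ : ℕ}

theorem radialExt_polyFun {p : MvPolynomial (Fin (d + 1)) ℝ} (hp : p.IsHomogeneous ℓ)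
    {y : EuclideanSpace ℝ (Fin (d + 1))} (hy : y ≠ 0) :
    radialExt (fun x : USphere (d + 1) => polyFun p x) y
      = (‖y‖ ^ 2) ^ (-(ℓ : ℝ) / 2) * polyFun p y := by
  rw [radialExt_of_ne hy (norm_inv_smul_mem_sphere hy), polyFun_smul hp, inv_pow,
    ← Real.rpow_natCast ‖y‖ 2, ← Real.rpow_mul (norm_nonneg y), ← Real.rpow_natCast ‖y‖ ℓ,
    ← Real.rpow_neg (norm_nonneg y)]
  congr 2
  push_cast
  ring

theorem norm_sq_line (x : EuclideanSpace ℝ (Fin (d + 1))) (hx : ‖x‖ = 1) (i : Fin (d + 1))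
    (t : ℝ) : ‖x + t • EuclideanSpace.single i (1 : ℝ)‖ ^ 2 = 1 + 2 * t * x i + t ^ 2 := by
  rw [norm_add_sq_real, hx, inner_smul_right, norm_smul, mul_pow]
  simp [EuclideanSpace.inner_single_right]
  ring

/-- Near the sphere the radial extension of `p` is `‖x‖ ^ (-ℓ) * p x`, whose Laplacian follows from
Euler's identity `∑ i, x i * ∂ᵢ p = ℓ p` and `Δ p = 0`. -/
theorem isHarmonic_polyFun {p : MvPolynomial (Fin (d + 1)) ℝ}
    (hp : p ∈ harmonicPoly (Fin (d + 1)) ℓ) :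
    IsHarmonic d ℓ fun x : USphere (d + 1) => polyFun p x := by
  obtain ⟨hhom : p.IsHomogeneous ℓ, hharm⟩ := hp
  rw [SetLike.mem_coe, LinearMap.mem_ker] at hharm
  have := fact_finrank_euclideanSpace (d + 1)
  have hsm : ContMDiff (𝓡 d) 𝓘(ℝ, ℝ) ∞ fun x : USphere (d + 1) => polyFun p x :=
    (contDiff_polyFun p).contMDiff.comp contMDiff_coe_sphere
  refine ⟨hsm, fun x => ?_⟩
  have hx : (x : EuclideanSpace ℝ (Fin (d + 1))) ≠ 0 := ne_zero_of_mem_unit_sphere x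
  have hx1 : ‖(x : EuclideanSpace ℝ (Fin (d + 1)))‖ = 1 := by simp
  set y : EuclideanSpace ℝ (Fin (d + 1)) := x.1 with hy
  set s : ℝ := -(ℓ : ℝ) / 2 with hs
  have hdiff : ContDiffAt ℝ 2 (radialExt fun x : USphere (d + 1) => polyFun p x) y :=
    (contDiffAt_radialExt hsm hx).of_le (WithTop.coe_le_coe.mpr le_top)
  have key : ∀ i, iteratedFDeriv ℝ 2 (radialExt fun x : USphere (d + 1) => polyFun p x) y
      ![EuclideanSpace.single i (1 : ℝ), EuclideanSpace.single i (1 : ℝ)]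
      = 2 * s * polyFun p y + 4 * s * (s - 1) * polyFun p y * (y i * y i)
        + 4 * s * (y i * polyFun (pderiv i p) y) + polyFun (pderiv i (pderiv i p)) y := by
    intro i
    -- `q t = ‖y + t eᵢ‖ ^ 2`, so that the extension equals `q ^ s * p` along this line.
    set q : ℝ → ℝ := fun t => 1 + 2 * t * y i + t ^ 2 with hq
    have hq0 : q 0 = 1 := by simp [hq]
    have hqd : ∀ t, HasDerivAt q (2 * y i + 2 * t) t := fun t => by
      have h := (((hasDerivAt_id t).const_mul (2 * y i)).add ((hasDerivAt_id t).pow 2)).const_add 1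
      refine (h.congr_deriv (by simp)).congr_of_eventuallyEq (Eventually.of_forall fun u => ?_)
      simp [hq]; ring
    have hqpos : ∀ᶠ t in nhds (0 : ℝ), 0 < q t :=
      (hqd 0).continuousAt.eventually (lt_mem_nhds (by rw [hq0]; norm_num))
    have hqr : ∀ r t, 0 < q t → HasDerivAt (fun t => q t ^ r)
        ((2 * y i + 2 * t) * r * q t ^ (r - 1)) t := fun r t ht =>
      (hqd t).rpow_const (Or.inl ht.ne')
    have hP : ∀ (p : MvPolynomial (Fin (d + 1)) ℝ) (t : ℝ), HasDerivAt
        (fun t : ℝ => polyFun p (y + t • EuclideanSpace.single i 1))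
        (polyFun (pderiv i p) (y + t • EuclideanSpace.single i 1)) t :=
      fun p t => hasDerivAt_polyFun_line p y i t
    have hF : ∀ t, 0 < q t → radialExt (fun x : USphere (d + 1) => polyFun p x)
        (y + t • EuclideanSpace.single i 1)
        = q t ^ s * polyFun p (y + t • EuclideanSpace.single i 1) := by
      intro t ht
      have hn := norm_sq_line y hx1 i t
      have hne : y + t • EuclideanSpace.single i (1 : ℝ) ≠ 0 := by
        intro h0
        rw [h0] at hn
        simp only [hq] at ht
        simp at hn
        linarith
      rw [radialExt_polyFun hhom hne, hn]
    refine iteratedFDeriv_two_diag hdiff _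
      (g := fun t => (2 * y i + 2 * t) * s * q t ^ (s - 1)
        * polyFun p (y + t • EuclideanSpace.single i 1)
        + q t ^ s * polyFun (pderiv i p) (y + t • EuclideanSpace.single i 1)) ?_ ?_
    · filter_upwards [hqpos.eventually_nhds] with t ht
      exact ((hqr s t ht.self_of_nhds).mul (hP p t)).congr_of_eventuallyEq (ht.mono hF)
    · have h0 : 0 < q 0 := by rw [hq0]; norm_num
      have hlin : HasDerivAt (fun t : ℝ => (2 * y i + 2 * t) * s) (2 * s) 0 := by
        simpa using (((hasDerivAt_id (0 : ℝ)).const_mul 2).const_add (2 * y i)).mul_const s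
      have h := ((hlin.mul (hqr (s - 1) 0 h0)).mul (hP p 0)).add
        ((hqr s 0 h0).mul (hP (pderiv i p) 0))
      refine h.congr_deriv ?_
      simp only [Pi.mul_apply, hq0, Real.one_rpow, zero_smul, add_zero, mul_zero]
      ring
  rw [laplaceBeltrami, InnerProductSpace.laplacian_eq_iteratedFDeriv_orthonormalBasis _
    (EuclideanSpace.basisFun (Fin (d + 1)) ℝ)]
  simp only [EuclideanSpace.basisFun_apply]
  have hsq : ∑ i, y i * y i = 1 := by
    have h := EuclideanSpace.real_norm_sq_eq y
    rw [hx1] at h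
    simp only [← sq]
    rw [← h]; norm_num
  rw [Finset.sum_congr rfl fun i _ => key i]
  simp only [Finset.sum_add_distrib, ← Finset.mul_sum, hsq, sum_mul_polyFun_pderiv hhom,
    sum_polyFun_pderiv_pderiv hharm, Finset.sum_const, Finset.card_univ, Fintype.card_fin,
    nsmul_eq_mul]
  rw [hs]
  push_cast
  ring

theorem eq_zero_of_polyFun_eq_zero {p : MvPolynomial (Fin (d + 1)) ℝ} (hp : p.IsHomogeneous ℓ)
    (hℓ : 1 ≤ ℓ) (h : ∀ x : USphere (d + 1), polyFun p x = 0) : p = 0 := by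
  apply MvPolynomial.funext
  intro v
  rw [map_zero]
  set x : EuclideanSpace ℝ (Fin (d + 1)) := WithLp.toLp 2 v
  change polyFun p x = 0
  by_cases hx : x = 0
  · have := polyFun_smul hp 0 x
    rw [zero_pow (by omega), zero_mul] at this
    simpa [hx] using this
  · have h1 := h ⟨_, norm_inv_smul_mem_sphere hx⟩
    rw [polyFun_smul hp] at h1
    have h2 : (‖x‖⁻¹ : ℝ) ^ ℓ ≠ 0 := pow_ne_zero _ (inv_ne_zero (norm_ne_zero_iff.mpr hx))
    exact (mul_eq_zero.mp h1).resolve_left h2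

/-- The harmonic homogeneous polynomials embed into the span of `Y`. Equality holds, but a lower bound
for `N` is what the concentration estimate requires. -/
theorem IsHarmonicBasis.harmonicDim_le {N : ℕ} {Y : Fin N → USphere (d + 1) → ℝ}
    (hY : IsHarmonicBasis d ℓ Y) (hd : 2 ≤ d) (hℓ : 1 ≤ ℓ) : harmonicDim d ℓ ≤ N := by
  let T : (Fin N → ℝ) →ₗ[ℝ] (USphere (d + 1) → ℝ) :=
    Fintype.linearCombination ℝ Y
  let S : harmonicPoly (Fin (d + 1)) ℓ →ₗ[ℝ] (USphere (d + 1) → ℝ) :=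
    { toFun := fun p x => polyFun p.1 x
      map_add' := fun p q => by ext x; simp [polyFun]
      map_smul' := fun c p => by ext x; simp [polyFun] }
  have hinj : Function.Injective S := by
    rw [← LinearMap.ker_eq_bot, LinearMap.ker_eq_bot']
    intro p hp
    exact Subtype.ext (eq_zero_of_polyFun_eq_zero p.2.1 hℓ fun x => congrFun hp x)
  have hle : LinearMap.range S ≤ LinearMap.range T := by
    rintro _ ⟨p, rfl⟩
    obtain ⟨c, hc⟩ := hY.spans _ (isHarmonic_polyFun p.2)
    refine ⟨c, ?_⟩
    ext x
    simpa [T, S, Fintype.linearCombination_apply] using (hc x).symm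
  have h1 : Module.finrank ℝ (harmonicPoly (Fin (d + 1)) ℓ) ≤ N := by
    rw [← LinearMap.finrank_range_of_inj hinj]
    refine (Submodule.finrank_mono hle).trans ((LinearMap.finrank_range_le T).trans ?_)
    simp
  refine (harmonicDim_le_finrank_harmonicPoly d ℓ hd hℓ).trans ?_
  exact_mod_cast h1

end

/-! ### The addition theorem -/

section

variable {d ℓ N : ℕ} {Y : Fin N → USphere (d + 1) → ℝ}

theorem integrable_of_continuous {n : ℕ} [NeZero n] {f : USphere n → ℝ} (hf : Continuous f) :
    Integrable f (unif n) :=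
  hf.integrable_of_hasCompactSupport (HasCompactSupport.of_compactSpace f)

namespace IsHarmonicBasis

theorem continuous (hY : IsHarmonicBasis d ℓ Y) (m : Fin N) : Continuous (Y m) :=
  (hY.harmonic m).continuous

theorem integral_sum_mul_sum (hY : IsHarmonicBasis d ℓ Y) (a b : Fin N → ℝ) :
    ∫ x, (∑ m, a m * Y m x) * (∑ m, b m * Y m x) ∂(unif (d + 1)) = ∑ m, a m * b m := by
  have hc := hY.continuous
  have h : ∀ x, (∑ m, a m * Y m x) * (∑ m, b m * Y m x)
      = ∑ m, ∑ m', a m * b m' * (Y m x * Y m' x) := fun x => by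
    rw [Finset.sum_mul_sum]
    exact Finset.sum_congr rfl fun m _ => Finset.sum_congr rfl fun m' _ => by ring
  simp_rw [h]
  rw [integral_finsetSum _ fun m _ => integrable_of_continuous (by fun_prop)]
  refine Finset.sum_congr rfl fun m _ => ?_
  rw [integral_finsetSum _ fun m' _ => integrable_of_continuous (by fun_prop)]
  simp_rw [integral_const_mul, hY.orthonormal]
  simp

/-- A rotation acts on the span of `Y` by an orthogonal matrix. -/
theorem exists_orthogonal (hY : IsHarmonicBasis d ℓ Y)
    (R : EuclideanSpace ℝ (Fin (d + 1)) ≃ₗᵢ[ℝ] EuclideanSpace ℝ (Fin (d + 1))) :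
    ∃ C : Matrix (Fin N) (Fin N) ℝ, (∀ m x, Y m (rot R x) = ∑ k, C m k * Y k x) ∧
      C.transpose * C = 1 := by
  choose C hC using fun m => hY.spans _ ((hY.harmonic m).comp_rot R)
  refine ⟨Matrix.of C, fun m x => hC m x, ?_⟩
  rw [_root_.mul_eq_one_comm]
  ext m m'
  rw [Matrix.mul_apply]
  simp only [Matrix.transpose_apply, Matrix.of_apply, Matrix.one_apply]
  rw [← hY.integral_sum_mul_sum (C m) (C m')]
  simp_rw [← hC, Function.comp_apply]
  rw [integral_comp_rot R (f := fun x => Y m x * Y m' x)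
    ((hY.continuous m).mul (hY.continuous m')), hY.orthonormal]

/-- The addition theorem on the diagonal: `∑ m, Y_m ^ 2` is rotation invariant, so it is constant,
and the constant is its mean. -/
theorem sum_sq (hY : IsHarmonicBasis d ℓ Y) (x : USphere (d + 1)) : ∑ m, Y m x ^ 2 = N := by
  have hinv : ∀ y, ∑ m, Y m y ^ 2 = ∑ m, Y m x ^ 2 := by
    intro y
    obtain ⟨R, rfl⟩ := exists_rot_eq x y
    obtain ⟨C, hC, hCC⟩ := hY.exists_orthogonal R
    have h1 : (fun m => Y m (rot R x)) = C.mulVec fun m => Y m x := by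
      ext m; rw [hC]; rfl
    have h2 : (C.mulVec fun m => Y m x) ⬝ᵥ (C.mulVec fun m => Y m x)
        = (fun m => Y m x) ⬝ᵥ fun m => Y m x := by
      rw [Matrix.dotProduct_mulVec, Matrix.vecMul_mulVec, hCC, Matrix.vecMul_one]
    rw [← h1] at h2
    simpa [dotProduct, sq] using h2
  have hc := hY.continuous
  have h3 : ∫ y, ∑ m, Y m y ^ 2 ∂(unif (d + 1)) = N := by
    rw [integral_finsetSum _ fun m _ => integrable_of_continuous (by fun_prop)]
    simp [sq, hY.orthonormal]
  rw [← h3]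
  simp_rw [hinv]
  simp

/-- Harmonics of positive degree have mean zero: the element of the span of `Y` that represents
the linear form `∫` is rotation invariant, hence a constant harmonic of positive degree. -/
theorem integral_eq_zero (hY : IsHarmonicBasis d ℓ Y) (hd : 2 ≤ d) (hℓ : 1 ≤ ℓ) (m : Fin N) :
    ∫ x, Y m x ∂(unif (d + 1)) = 0 := by
  set a : Fin N → ℝ := fun m => ∫ x, Y m x ∂(unif (d + 1)) with ha
  set g : USphere (d + 1) → ℝ := fun x => ∑ m, a m * Y m x with hg
  have hc := hY.continuous
  have hharm : IsHarmonic d ℓ g := by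
    have h := IsHarmonic.sum Finset.univ (fun m => a m • Y m)
      fun m => (hY.harmonic m).const_smul (a m)
    convert h using 1
    ext x
    simp [hg]
  have hinv : ∀ x y, g y = g x := by
    intro x y
    obtain ⟨R, rfl⟩ := exists_rot_eq x y
    obtain ⟨C, hC, hCC⟩ := hY.exists_orthogonal R
    have h1 : (fun m => Y m (rot R x)) = C.mulVec fun m => Y m x := by
      ext m; rw [hC]; rfl
    have h2 : a = C.mulVec a := by
      ext m
      have := integral_comp_rot R (hY.continuous m)
      simp_rw [hC] at this
      rw [integral_finsetSum _ fun m _ => integrable_of_continuous (by fun_prop)] at this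
      simp_rw [integral_const_mul] at this
      exact this.symm
    change a ⬝ᵥ (fun m => Y m (rot R x)) = a ⬝ᵥ fun m => Y m x
    rw [h1]
    conv_lhs => rw [h2]
    rw [Matrix.dotProduct_mulVec, Matrix.vecMul_mulVec, hCC, Matrix.vecMul_one]
  have x₀ : USphere (d + 1) := ⟨EuclideanSpace.single 0 1, by simp⟩
  have hg0 : ∀ x, g x = 0 := hharm.eq_zero_of_const hd hℓ (g x₀) (hinv x₀)
  have h := hY.integral_sum_mul_sum a a
  have h0 : ∑ m, a m * a m = 0 := by
    rw [← h]
    change ∫ x, g x * g x ∂(unif (d + 1)) = 0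
    simp [hg0]
  have := (Finset.sum_eq_zero_iff_of_nonneg fun m _ => mul_self_nonneg (a m)).mp h0 m
    (Finset.mem_univ m)
  exact mul_self_eq_zero.mp this

end IsHarmonicBasis

/-- The unit vector `(Y_1(x), …, Y_N(x)) / √N`. -/
def featureVec (Y : Fin N → USphere (d + 1) → ℝ) (x : USphere (d + 1)) :
    EuclideanSpace ℝ (Fin N) :=
  WithLp.toLp 2 fun m => Y m x / √N

theorem inner_featureVec (x y : USphere (d + 1)) :
    inner ℝ (featureVec Y x) (featureVec Y y) = (∑ m, Y m x * Y m y) / N := by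
  simp only [featureVec, PiLp.inner_apply, RCLike.inner_apply, conj_trivial, Finset.sum_div]
  refine Finset.sum_congr rfl fun m _ => ?_
  rw [div_mul_div_comm, Real.mul_self_sqrt (by positivity), mul_comm]

namespace IsHarmonicBasis

theorem norm_featureVec (hY : IsHarmonicBasis d ℓ Y) (hN : N ≠ 0) (x : USphere (d + 1)) :
    ‖featureVec Y x‖ = 1 := by
  have h : ‖featureVec Y x‖ ^ 2 = 1 := by
    rw [← real_inner_self_eq_norm_sq, inner_featureVec]
    simp_rw [← sq]
    rw [hY.sum_sq, div_self (by exact_mod_cast hN)]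
  nlinarith [norm_nonneg (featureVec Y x)]

theorem continuous_featureVec (hY : IsHarmonicBasis d ℓ Y) : Continuous (featureVec Y) := by
  have hc := hY.continuous
  unfold featureVec
  fun_prop

theorem integral_inner_featureVec (hY : IsHarmonicBasis d ℓ Y) (hd : 2 ≤ d) (hℓ : 1 ≤ ℓ)
    (x : USphere (d + 1)) :
    ∫ y, inner ℝ (featureVec Y x) (featureVec Y y) ∂(unif (d + 1)) = 0 := by
  have hc := hY.continuous
  simp_rw [inner_featureVec]
  rw [integral_div, integral_finsetSum _ fun m _ => integrable_of_continuous (by fun_prop)]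
  simp [integral_const_mul, hY.integral_eq_zero hd hℓ]

theorem integral_inner_featureVec_sq (hY : IsHarmonicBasis d ℓ Y) (hN : N ≠ 0)
    (x : USphere (d + 1)) :
    ∫ y, (inner ℝ (featureVec Y x) (featureVec Y y)) ^ 2 ∂(unif (d + 1)) = 1 / N := by
  simp_rw [inner_featureVec, div_pow]
  rw [integral_div]
  simp_rw [sq (∑ m, _)]
  rw [hY.integral_sum_mul_sum (fun m => Y m x) fun m => Y m x]
  simp_rw [← sq]
  rw [hY.sum_sq]
  have : (N : ℝ) ≠ 0 := by exact_mod_cast hN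
  field_simp

end IsHarmonicBasis

end

/-! ### The standard Gaussian distribution function -/

section

/-- The distribution function of the standard Gaussian law. -/
def gaussCDF (u : ℝ) : ℝ := (gaussianReal 0 1).real (Set.Iic u)

/-- The standard Gaussian density. -/
def gaussPDF (u : ℝ) : ℝ := gaussianPDFReal 0 1 u

theorem gaussPDF_eq (u : ℝ) : gaussPDF u = (√(2 * Real.pi))⁻¹ * Real.exp (-u ^ 2 / 2) := by
  simp [gaussPDF, gaussianPDFReal]

theorem continuous_gaussPDF : Continuous gaussPDF := by
  simp_rw [funext gaussPDF_eq]
  fun_prop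

theorem inv_sqrt_two_pi_le : (√(2 * Real.pi))⁻¹ ≤ 1 / 2 := by
  rw [inv_eq_one_div]
  refine one_div_le_one_div_of_le (by norm_num) (Real.le_sqrt_of_sq_le ?_)
  linarith [Real.pi_gt_three]

theorem gaussPDF_nonneg (u : ℝ) : 0 ≤ gaussPDF u := gaussianPDFReal_nonneg _ _ _

theorem gaussPDF_le_one (u : ℝ) : gaussPDF u ≤ 1 := by
  rw [gaussPDF_eq]
  have h : Real.exp (-u ^ 2 / 2) ≤ 1 := Real.exp_le_one_iff.mpr (by nlinarith [sq_nonneg u])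
  calc _ ≤ (1 / 2 : ℝ) * 1 := mul_le_mul inv_sqrt_two_pi_le h (by positivity) (by norm_num)
    _ ≤ 1 := by norm_num

theorem abs_mul_gaussPDF_le (u v : ℝ) (h : |u| / 2 ≤ |v|) : |u| * gaussPDF v ≤ 1 := by
  rw [gaussPDF_eq]
  have h1 : u ^ 2 / 8 ≤ v ^ 2 / 2 := by
    rw [← sq_abs u, ← sq_abs v]
    nlinarith [abs_nonneg u]
  have h2 : Real.exp (-v ^ 2 / 2) * (1 + u ^ 2 / 8) ≤ 1 := by
    have h3 : 1 + u ^ 2 / 8 ≤ Real.exp (v ^ 2 / 2) := by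
      linarith [Real.add_one_le_exp (v ^ 2 / 2)]
    calc _ ≤ Real.exp (-v ^ 2 / 2) * Real.exp (v ^ 2 / 2) := by gcongr
      _ = 1 := by rw [← Real.exp_add]; ring_nf; simp
  have h4 : |u| ≤ 2 * (1 + u ^ 2 / 8) := by
    rw [← sq_abs u]
    nlinarith [sq_nonneg (|u| - 2)]
  have h5 := inv_sqrt_two_pi_le
  have h6 : 0 < Real.exp (-v ^ 2 / 2) := Real.exp_pos _
  calc |u| * ((√(2 * Real.pi))⁻¹ * Real.exp (-v ^ 2 / 2))
      ≤ (2 * (1 + u ^ 2 / 8)) * (1 / 2 * Real.exp (-v ^ 2 / 2)) := by gcongr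
    _ ≤ 1 := by linarith

theorem hasDerivAt_gaussPDF (u : ℝ) : HasDerivAt gaussPDF (-u * gaussPDF u) u := by
  have h : HasDerivAt (fun u : ℝ => (√(2 * Real.pi))⁻¹ * Real.exp (-u ^ 2 / 2))
      ((√(2 * Real.pi))⁻¹ * (Real.exp (-u ^ 2 / 2) * (-(2 * u) / 2))) u := by
    have h1 : HasDerivAt (fun u : ℝ => -u ^ 2 / 2) (-(2 * u) / 2) u := by
      simpa using ((hasDerivAt_pow 2 u).neg).div_const 2
    exact h1.exp.const_mul _
  rw [funext gaussPDF_eq]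
  refine h.congr_deriv ?_
  ring

theorem abs_gaussPDF_sub_le (u v : ℝ) : |gaussPDF v - gaussPDF u| ≤ |v - u| := by
  have h := Convex.norm_image_sub_le_of_norm_hasDerivWithin_le (f := gaussPDF)
    (f' := fun u => -u * gaussPDF u) (C := 1) (s := Set.univ) (x := u) (y := v)
    (fun x _ => (hasDerivAt_gaussPDF x).hasDerivWithinAt)
    (fun x _ => by
      rw [Real.norm_eq_abs, abs_mul, abs_neg, abs_of_nonneg (gaussPDF_nonneg x)]
      exact abs_mul_gaussPDF_le x x (by linarith [abs_nonneg x]))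
    convex_univ (Set.mem_univ _) (Set.mem_univ _)
  simpa using h

theorem hasDerivAt_gaussCDF (u : ℝ) : HasDerivAt gaussCDF (gaussPDF u) u := by
  have h : gaussCDF = fun u => gaussCDF 0 + ∫ t in (0 : ℝ)..u, gaussPDF t := by
    ext u
    have h1 : ∀ u, gaussCDF u = ∫ t in Set.Iic u, gaussPDF t := fun u => by
      rw [gaussCDF, measureReal_def, gaussianReal_apply_eq_integral _ one_ne_zero,
        ENNReal.toReal_ofReal (integral_nonneg fun x => gaussianPDFReal_nonneg 0 1 x)]
      rfl
    have hi : Integrable gaussPDF := integrable_gaussianPDFReal 0 1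
    rw [h1, h1, ← intervalIntegral.integral_Iic_sub_Iic hi.integrableOn hi.integrableOn]
    ring
  rw [h]
  exact (intervalIntegral.integral_hasDerivAt_right (continuous_gaussPDF.intervalIntegrable _ _)
    (continuous_gaussPDF.stronglyMeasurableAtFilter _ _) continuous_gaussPDF.continuousAt).const_add _

theorem continuous_gaussCDF : Continuous gaussCDF :=
  continuous_iff_continuousAt.mpr fun u => (hasDerivAt_gaussCDF u).continuousAt

theorem gaussCDF_nonneg (u : ℝ) : 0 ≤ gaussCDF u := measureReal_nonneg

theorem gaussCDF_le_one (u : ℝ) : gaussCDF u ≤ 1 := measureReal_le_one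

theorem abs_gaussCDF_taylor (u s : ℝ) :
    |gaussCDF s - gaussCDF u - gaussPDF u * (s - u)| ≤ (s - u) ^ 2 := by
  have h := Convex.norm_image_sub_le_of_norm_hasDerivWithin_le
    (f := fun t => gaussCDF t - gaussPDF u * t)
    (f' := fun t => gaussPDF t - gaussPDF u) (C := |s - u|) (s := Set.uIcc u s) (x := u) (y := s)
    (fun x _ => by
      have := (hasDerivAt_gaussCDF x).sub ((hasDerivAt_id x).const_mul (gaussPDF u))
      simpa using! this.hasDerivWithinAt)
    (fun x hx => by
      rw [Real.norm_eq_abs]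
      refine (abs_gaussPDF_sub_le u x).trans ?_
      exact Set.abs_sub_left_of_mem_uIcc hx)
    (convex_uIcc u s) Set.left_mem_uIcc Set.right_mem_uIcc
  rw [Real.norm_eq_abs, Real.norm_eq_abs, abs_mul_abs_self] at h
  calc _ = |gaussCDF s - gaussPDF u * s - (gaussCDF u - gaussPDF u * u)| := by ring_nf
    _ ≤ _ := h
    _ = (s - u) ^ 2 := by ring

theorem abs_gaussCDF_mul_sub_le (u r : ℝ) (hr : |r - 1| ≤ 1 / 2) :
    |gaussCDF (r * u) - gaussCDF u| ≤ |r - 1| := by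
  have h := Convex.norm_image_sub_le_of_norm_hasDerivWithin_le
    (f := fun t => gaussCDF (t * u))
    (f' := fun t => gaussPDF (t * u) * u) (C := 1) (s := Set.Icc (1 / 2) (3 / 2)) (x := 1) (y := r)
    (fun x _ => by
      have := (hasDerivAt_gaussCDF (x * u)).comp x ((hasDerivAt_id x).mul_const u)
      simpa using! this.hasDerivWithinAt)
    (fun x hx => by
      rw [Real.norm_eq_abs, abs_mul, abs_of_nonneg (gaussPDF_nonneg _), mul_comm]
      refine abs_mul_gaussPDF_le _ _ ?_
      rw [abs_mul, abs_of_nonneg (by linarith [hx.1] : (0 : ℝ) ≤ x)]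
      nlinarith [hx.1, abs_nonneg u])
    (convex_Icc _ _) (by constructor <;> norm_num)
    (by rw [abs_le] at hr; constructor <;> linarith)
  simpa using h

/-- First-order expansion in the correlation `ρ` of the conditional distribution function
`P(ρ a + √(1 - ρ²) W ≤ u)`. -/
theorem abs_gaussCDF_cond_le (u a ρ : ℝ) (hρ : |ρ| ≤ 1 / 2) :
    |gaussCDF ((u - ρ * a) / √(1 - ρ ^ 2)) - gaussCDF u + ρ * (gaussPDF u * a)|
      ≤ ρ ^ 2 * (10 + 10 * u ^ 2 + 10 * a ^ 2) := by
  have hρ2 : ρ ^ 2 ≤ 1 / 4 := by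
    rw [← sq_abs]; nlinarith [abs_nonneg ρ]
  set c := √(1 - ρ ^ 2) with hc
  have hc2 : c ^ 2 = 1 - ρ ^ 2 := Real.sq_sqrt (by linarith)
  have hc0 : 0 ≤ c := Real.sqrt_nonneg _
  have hc1 : 3 / 4 ≤ c := by nlinarith
  have hc3 : c ≤ 1 := by nlinarith [sq_nonneg ρ]
  set θ := (1 - c) / c with hθ
  have hθ0 : 0 ≤ θ := div_nonneg (by linarith) (by linarith)
  have hθ1 : θ ≤ ρ ^ 2 := by
    rw [hθ, div_le_iff₀ (by linarith)]
    nlinarith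
  have hs : (u - ρ * a) / c - u = -ρ * a + (u - ρ * a) * θ := by
    rw [hθ]; field_simp; ring
  have ht := abs_gaussCDF_taylor u ((u - ρ * a) / c)
  rw [hs] at ht
  have hφ0 := gaussPDF_nonneg u
  have hφ1 := gaussPDF_le_one u
  have e1 : |gaussPDF u * ((u - ρ * a) * θ)| ≤ ρ ^ 2 * (1 + u ^ 2 + a ^ 2) := by
    rw [abs_mul, abs_mul, abs_of_nonneg hφ0, abs_of_nonneg hθ0]
    have h1 : |u - ρ * a| ≤ 1 + u ^ 2 + a ^ 2 := by
      rw [abs_le]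
      have h4 : (ρ * a) ^ 2 ≤ a ^ 2 := by nlinarith [sq_nonneg a]
      constructor <;> nlinarith [sq_nonneg (u - 1), sq_nonneg (u + 1), sq_nonneg (ρ * a - 1),
        sq_nonneg (ρ * a + 1)]
    calc gaussPDF u * (|u - ρ * a| * θ) ≤ 1 * ((1 + u ^ 2 + a ^ 2) * ρ ^ 2) := by gcongr
      _ = _ := by ring
  have e2 : (-ρ * a + (u - ρ * a) * θ) ^ 2 ≤ ρ ^ 2 * (8 * u ^ 2 + 8 * a ^ 2) := by
    have h2 : ((u - ρ * a) * θ) ^ 2 ≤ ρ ^ 2 * (2 * u ^ 2 + 2 * a ^ 2) := by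
      have h3 : (u - ρ * a) ^ 2 ≤ 2 * u ^ 2 + 2 * a ^ 2 := by
        nlinarith [sq_nonneg (u + ρ * a), sq_nonneg a]
      have h4 : θ ^ 2 ≤ ρ ^ 2 := by nlinarith
      rw [mul_pow, mul_comm (ρ ^ 2)]
      gcongr
    nlinarith [sq_nonneg (-ρ * a - (u - ρ * a) * θ), mul_nonneg (sq_nonneg ρ) (sq_nonneg u),
      mul_nonneg (sq_nonneg ρ) (sq_nonneg a)]
  rw [abs_le] at ht e1 ⊢
  have p1 := mul_nonneg (sq_nonneg ρ) (sq_nonneg u)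
  have p2 := mul_nonneg (sq_nonneg ρ) (sq_nonneg a)
  constructor <;> nlinarith [sq_nonneg ρ]

end

/-! ### Pairs of correlated Gaussian variables -/

section

section GaussianVector

variable {E : Type*} [NormedAddCommGroup E] [InnerProductSpace ℝ E] [FiniteDimensional ℝ E]
  [MeasurableSpace E] [BorelSpace E]

theorem map_inner_stdGaussian {e : E} (he : ‖e‖ = 1) :
    (stdGaussian E).map (fun g => inner ℝ e g) = gaussianReal 0 1 := by
  have h := IsGaussian.map_eq_gaussianReal (μ := stdGaussian E) (innerSL ℝ e)
  rw [integral_strongDual_stdGaussian, variance_dual_stdGaussian, innerSL_apply_norm, he] at h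
  simpa using! h

theorem map_inner_inner_stdGaussian {e f : E} (he : ‖e‖ = 1) (hf : ‖f‖ = 1)
    (hef : inner ℝ e f = 0) :
    (stdGaussian E).map (fun g => (inner ℝ e g, inner ℝ f g)) =
      (gaussianReal 0 1).prod (gaussianReal 0 1) := by
  have hlaw : HasGaussianLaw (fun g : E => (inner ℝ e g, inner ℝ f g)) (stdGaussian E) :=
    (IsGaussian.hasGaussianLaw_id (μ := stdGaussian E)).map ((innerSL ℝ e).prod (innerSL ℝ f))
  have hcov : cov[fun g => inner ℝ e g, fun g => inner ℝ f g; stdGaussian E] = 0 := by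
    rw [← covarianceBilin_apply_eq_cov (IsGaussian.memLp_id _ 2 (by simp)),
      covarianceBilin_stdGaussian]
    exact hef
  have hind := hlaw.indepFun_of_covariance_eq_zero hcov
  rw [(indepFun_iff_map_prod_eq_prod_map_map (by fun_prop) (by fun_prop)).mp hind,
    map_inner_stdGaussian he, map_inner_stdGaussian hf]

/-- `P(⟨e, G⟩ ≤ u, ⟨f, G⟩ ≤ u)` for a standard Gaussian vector `G`. -/
def jointCDF (e f : E) (u : ℝ) : ℝ :=
  (stdGaussian E).real {g | inner ℝ e g ≤ u ∧ inner ℝ f g ≤ u}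

theorem gaussCDF_eq_stdGaussian {e : E} (he : ‖e‖ = 1) (u : ℝ) :
    (stdGaussian E).real {g | inner ℝ e g ≤ u} = gaussCDF u := by
  rw [gaussCDF, ← map_inner_stdGaussian he, map_measureReal_apply (by fun_prop) measurableSet_Iic]
  rfl

/-- Conditioning on `⟨e, G⟩ = a`: given this, `⟨f, G⟩` is Gaussian of mean `ρ a` and variance
`1 - ρ ^ 2`, where `ρ = ⟨e, f⟩`. -/
theorem jointCDF_eq_integral {e f : E} (he : ‖e‖ = 1) (hf : ‖f‖ = 1) (u : ℝ)
    (hρ : |inner ℝ e f| < 1) :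
    jointCDF e f u = ∫ a in Set.Iic u,
      gaussCDF ((u - inner ℝ e f * a) / √(1 - inner ℝ e f ^ 2)) ∂(gaussianReal 0 1) := by
  set ρ : ℝ := inner ℝ e f with hρdef
  have hρ2 : 0 < 1 - ρ ^ 2 := by
    rw [← sq_abs]
    nlinarith [abs_nonneg ρ]
  set c := √(1 - ρ ^ 2) with hc
  have hc0 : 0 < c := Real.sqrt_pos.mpr hρ2
  have hc2 : c ^ 2 = 1 - ρ ^ 2 := Real.sq_sqrt hρ2.le
  -- The component of `f` orthogonal to `e`, normalized.
  set f' : E := c⁻¹ • (f - ρ • e) with hf'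
  have hsplit : f = ρ • e + c • f' := by
    rw [hf', smul_inv_smul₀ hc0.ne']; abel
  have hee : inner ℝ e e = (1 : ℝ) := by rw [real_inner_self_eq_norm_sq, he]; norm_num
  have hff : inner ℝ f f = (1 : ℝ) := by rw [real_inner_self_eq_norm_sq, hf]; norm_num
  have horth : inner ℝ e f' = 0 := by
    rw [hf', inner_smul_right, inner_sub_right, inner_smul_right, hee, ← hρdef]
    ring
  have hnorm : ‖f'‖ = 1 := by
    have : ‖f'‖ ^ 2 = 1 := by
      rw [hf', norm_smul, mul_pow, norm_sub_sq_real, hf, norm_smul, he, inner_smul_right,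
        real_inner_comm, ← hρdef, Real.norm_eq_abs, Real.norm_eq_abs, mul_one, sq_abs, sq_abs,
        inv_pow, hc2]
      field_simp
      ring
    nlinarith [norm_nonneg f']
  have hpair := map_inner_inner_stdGaussian he hnorm horth
  have hset : MeasurableSet {p : ℝ × ℝ | p.1 ≤ u ∧ ρ * p.1 + c * p.2 ≤ u} :=
    (measurableSet_le measurable_fst measurable_const).inter
      (measurableSet_le ((measurable_fst.const_mul ρ).add (measurable_snd.const_mul c))
        measurable_const)
  have h1 : jointCDF e f u = ((gaussianReal 0 1).prod (gaussianReal 0 1)).real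
      {p : ℝ × ℝ | p.1 ≤ u ∧ ρ * p.1 + c * p.2 ≤ u} := by
    rw [← hpair, map_measureReal_apply (by fun_prop) hset, jointCDF]
    congr 1
    ext g
    have : inner ℝ f g = ρ * inner ℝ e g + c * inner ℝ f' g := by
      conv_lhs => rw [hsplit]
      rw [inner_add_left, real_inner_smul_left, real_inner_smul_left]
    simp [this]
  rw [h1, measureReal_def, Measure.prod_apply hset, ← integral_toReal,
    ← integral_indicator measurableSet_Iic]
  · refine integral_congr_ae (Eventually.of_forall fun a => ?_)
    by_cases ha : a ≤ u
    · rw [Set.indicator_of_mem (by exact ha)]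
      simp only [gaussCDF, measureReal_def]
      congr 2
      ext b
      simp only [Set.mem_preimage, Set.mem_ofPred_eq, ha, true_and, Set.mem_Iic, le_div_iff₀ hc0]
      constructor <;> intro h <;> linarith
    · rw [Set.indicator_of_notMem (by exact ha)]
      have : Prod.mk a ⁻¹' {p : ℝ × ℝ | p.1 ≤ u ∧ ρ * p.1 + c * p.2 ≤ u} = ∅ := by
        ext b
        simp [ha]
      simp [this]
  · exact (measurable_measure_prodMk_left hset).aemeasurable
  · exact Eventually.of_forall fun a => measure_lt_top _ _

theorem integrable_sq_gaussianReal : Integrable (fun a : ℝ => a ^ 2) (gaussianReal 0 1) :=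
  (memLp_id_gaussianReal 2).integrable_sq

theorem integral_sq_gaussianReal : ∫ a, a ^ 2 ∂(gaussianReal 0 1) = 1 := by
  have h := variance_eq_integral (X := fun x : ℝ => x) (μ := gaussianReal 0 1)
    measurable_id.aemeasurable
  rw [variance_fun_id_gaussianReal, integral_id_gaussianReal] at h
  simpa using h.symm

theorem integrable_id_gaussianReal : Integrable (fun a : ℝ => a) (gaussianReal 0 1) :=
  (memLp_id_gaussianReal 1).integrable (by simp)

/-- The coefficient of `-ρ` in the expansion of `jointCDF`; its value is `-φ(u)²`, but only its size
matters. -/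
def jointCoeff (u : ℝ) : ℝ := gaussPDF u * ∫ a in Set.Iic u, a ∂(gaussianReal 0 1)

theorem abs_jointCoeff_le (u : ℝ) : |jointCoeff u| ≤ 1 := by
  have h : |∫ a in Set.Iic u, a ∂(gaussianReal 0 1)| ≤ 1 := by
    calc |∫ a in Set.Iic u, a ∂(gaussianReal 0 1)|
        ≤ ∫ a in Set.Iic u, |a| ∂(gaussianReal 0 1) := abs_integral_le_integral_abs
      _ ≤ ∫ a, |a| ∂(gaussianReal 0 1) :=
          setIntegral_le_integral integrable_id_gaussianReal.abs
            (Eventually.of_forall fun a => abs_nonneg a)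
      _ ≤ ∫ a, (1 + a ^ 2) / 2 ∂(gaussianReal 0 1) := by
          refine integral_mono integrable_id_gaussianReal.abs
            (((integrable_const 1).add integrable_sq_gaussianReal).div_const 2) fun a => ?_
          simp only
          rw [← sq_abs a]
          nlinarith [sq_nonneg (|a| - 1)]
      _ = 1 := by
          rw [integral_div, integral_add (integrable_const 1) integrable_sq_gaussianReal,
            integral_sq_gaussianReal]
          simp
  rw [jointCoeff, abs_mul, abs_of_nonneg (gaussPDF_nonneg u)]
  exact mul_le_one₀ (gaussPDF_le_one u) (abs_nonneg _) h

/-- Two Gaussian variables of correlation `ρ`: up to a term linear in `ρ`, the covariance of the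
events `{⟨e, G⟩ ≤ u}` and `{⟨f, G⟩ ≤ u}` is `O(ρ²)`. -/
theorem abs_jointCDF_sub_le {e f : E} (he : ‖e‖ = 1) (hf : ‖f‖ = 1) (u : ℝ) :
    |jointCDF e f u - gaussCDF u ^ 2 + inner ℝ e f * jointCoeff u|
      ≤ inner ℝ e f ^ 2 * (20 + 10 * u ^ 2) := by
  set ρ : ℝ := inner ℝ e f with hρ
  by_cases h : |ρ| ≤ 1 / 2
  · have hm : Measurable fun a => gaussCDF ((u - ρ * a) / √(1 - ρ ^ 2)) :=
      continuous_gaussCDF.measurable.comp (by fun_prop)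
    have hi1 : Integrable (fun a => gaussCDF ((u - ρ * a) / √(1 - ρ ^ 2))) (gaussianReal 0 1) :=
      Integrable.of_bound hm.aestronglyMeasurable 1 (Eventually.of_forall fun a => by
        rw [Real.norm_of_nonneg (gaussCDF_nonneg _)]; exact gaussCDF_le_one _)
    have hi2 : Integrable (fun a : ℝ => ρ * (gaussPDF u * a)) (gaussianReal 0 1) :=
      (integrable_id_gaussianReal.const_mul _).const_mul _
    have hi3 : Integrable (fun a : ℝ => ρ ^ 2 * (10 + 10 * u ^ 2 + 10 * a ^ 2))
        (gaussianReal 0 1) :=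
      ((integrable_const _).add (integrable_sq_gaussianReal.const_mul 10)).const_mul _
    have heq : jointCDF e f u - gaussCDF u ^ 2 + ρ * jointCoeff u
        = ∫ a in Set.Iic u, (gaussCDF ((u - ρ * a) / √(1 - ρ ^ 2)) - gaussCDF u
          + ρ * (gaussPDF u * a)) ∂(gaussianReal 0 1) := by
      have hi4 : Integrable (fun a => gaussCDF ((u - ρ * a) / √(1 - ρ ^ 2)) - gaussCDF u)
          (gaussianReal 0 1) := hi1.sub (integrable_const _)
      rw [integral_add hi4.integrableOn hi2.integrableOn,
        integral_sub hi1.integrableOn (integrable_const _), integral_const_mul,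
        integral_const_mul, jointCDF_eq_integral he hf u (by linarith), jointCoeff]
      simp only [integral_const, measureReal_restrict_apply_univ, smul_eq_mul, ← hρ]
      rw [← gaussCDF, sq (gaussCDF u)]
    rw [heq]
    calc _ ≤ ∫ a in Set.Iic u, |gaussCDF ((u - ρ * a) / √(1 - ρ ^ 2)) - gaussCDF u
          + ρ * (gaussPDF u * a)| ∂(gaussianReal 0 1) := abs_integral_le_integral_abs
      _ ≤ ∫ a, |gaussCDF ((u - ρ * a) / √(1 - ρ ^ 2)) - gaussCDF u
          + ρ * (gaussPDF u * a)| ∂(gaussianReal 0 1) :=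
          setIntegral_le_integral ((hi1.sub (integrable_const _)).add hi2).abs
            (Eventually.of_forall fun a => abs_nonneg _)
      _ ≤ ∫ a, ρ ^ 2 * (10 + 10 * u ^ 2 + 10 * a ^ 2) ∂(gaussianReal 0 1) :=
          integral_mono ((hi1.sub (integrable_const _)).add hi2).abs hi3
            fun a => abs_gaussCDF_cond_le u a ρ h
      _ = ρ ^ 2 * (20 + 10 * u ^ 2) := by
          rw [integral_const_mul, integral_add (integrable_const _)
            (integrable_sq_gaussianReal.const_mul 10), integral_const_mul,
            integral_sq_gaussianReal]
          simp
          ring_nf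
          simp
  -- For `|ρ| > 1 / 2` the right-hand side exceeds the trivial bound `2`.
  · have h1 : |ρ| ≤ 1 := by
      have := abs_real_inner_le_norm e f
      rwa [he, hf, mul_one] at this
    have h2 : 1 / 4 ≤ ρ ^ 2 := by
      rw [← sq_abs]; nlinarith
    have h3 : |ρ * jointCoeff u| ≤ 1 := by
      rw [abs_mul]
      exact mul_le_one₀ h1 (abs_nonneg _) (abs_jointCoeff_le u)
    have h4 : 0 ≤ jointCDF e f u := measureReal_nonneg
    have h5 : jointCDF e f u ≤ 1 := measureReal_le_one
    have h6 := gaussCDF_nonneg u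
    have h7 := gaussCDF_le_one u
    have h8 : gaussCDF u ^ 2 ≤ 1 := pow_le_one₀ h6 h7
    rw [abs_le] at h3 ⊢
    have h9 : 2 ≤ ρ ^ 2 * (20 + 10 * u ^ 2) := by
      nlinarith [mul_nonneg (sq_nonneg ρ) (sq_nonneg u)]
    constructor <;> nlinarith [sq_nonneg (gaussCDF u)]

end GaussianVector

end

/-! ### Variance of a random distribution function -/

section

theorem integrable_of_nonneg_of_le_one {Ω : Type*} [MeasurableSpace Ω] (κ : Measure Ω)
    [IsFiniteMeasure κ] {k : Ω → ℝ} (hk : Measurable k) (h0 : ∀ w, 0 ≤ k w)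
    (h1 : ∀ w, k w ≤ 1) : Integrable k κ :=
  Integrable.of_bound hk.aestronglyMeasurable 1
    (Eventually.of_forall fun w => by rw [Real.norm_of_nonneg (h0 w)]; exact h1 w)

theorem integral_le_one_of_nonneg_of_le_one {Ω : Type*} [MeasurableSpace Ω] (κ : Measure Ω)
    [IsProbabilityMeasure κ] {k : Ω → ℝ} (hk : Measurable k) (h0 : ∀ w, 0 ≤ k w)
    (h1 : ∀ w, k w ≤ 1) : ∫ w, k w ∂κ ≤ 1 := by
  have h := integral_mono (integrable_of_nonneg_of_le_one κ hk h0 h1) (integrable_const (1 : ℝ)) h1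
  simpa using h

/-- The variance of a random average, as a double average of covariances. -/
theorem integral_sq_integral_sub {G X : Type*} [MeasurableSpace G] [MeasurableSpace X]
    {ν : Measure G} [IsProbabilityMeasure ν] {μ : Measure X} [IsProbabilityMeasure μ]
    {f : G → X → ℝ} (hf : Measurable (Function.uncurry f)) (h0 : ∀ g x, 0 ≤ f g x)
    (h1 : ∀ g x, f g x ≤ 1) {p : ℝ} (hp : ∀ x, ∫ g, f g x ∂ν = p) :
    ∫ g, (∫ x, f g x ∂μ - p) ^ 2 ∂ν =
      ∫ z : X × X, (∫ g, f g z.1 * f g z.2 ∂ν - p ^ 2) ∂(μ.prod μ) ∧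
    Integrable (fun z : X × X => ∫ g, f g z.1 * f g z.2 ∂ν - p ^ 2) (μ.prod μ) := by
  set k : G → X × X → ℝ := fun g z => f g z.1 * f g z.2 with hk
  have hkm : Measurable (Function.uncurry k) :=
    (hf.comp (measurable_fst.prodMk (measurable_fst.comp measurable_snd))).mul
      (hf.comp (measurable_fst.prodMk (measurable_snd.comp measurable_snd)))
  have hk0 : ∀ g z, 0 ≤ k g z := fun g z => mul_nonneg (h0 _ _) (h0 _ _)
  have hk1 : ∀ g z, k g z ≤ 1 := fun g z => mul_le_one₀ (h1 _ _) (h0 _ _) (h1 _ _)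
  have hFm : Measurable fun g => ∫ x, f g x ∂μ :=
    hf.stronglyMeasurable.integral_prod_right.measurable
  have hfg : ∀ g, Measurable (f g) := fun g => hf.comp measurable_prodMk_left
  have hF0 : ∀ g, 0 ≤ ∫ x, f g x ∂μ := fun g => integral_nonneg (h0 g)
  have hF1 : ∀ g, ∫ x, f g x ∂μ ≤ 1 := fun g =>
    integral_le_one_of_nonneg_of_le_one μ (hfg g) (h0 g) (h1 g)
  have hJm : Measurable fun z => ∫ g, k g z ∂ν :=
    hkm.stronglyMeasurable.integral_prod_left.measurable
  have hJi : Integrable (fun z => ∫ g, k g z ∂ν) (μ.prod μ) :=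
    integrable_of_nonneg_of_le_one _ hJm (fun z => integral_nonneg fun g => hk0 g z) fun z =>
      integral_le_one_of_nonneg_of_le_one ν (hkm.comp measurable_prodMk_right) (fun g => hk0 g z)
        fun g => hk1 g z
  refine ⟨?_, hJi.sub (integrable_const _)⟩
  have hA : ∫ g, ∫ x, f g x ∂μ ∂ν = p := by
    rw [integral_integral_swap (integrable_of_nonneg_of_le_one _ hf (fun q => h0 _ _) fun q => h1 _ _)]
    simp [hp]
  have hB : ∫ g, (∫ x, f g x ∂μ) ^ 2 ∂ν = ∫ z, ∫ g, k g z ∂ν ∂(μ.prod μ) := by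
    rw [← integral_integral_swap
      (integrable_of_nonneg_of_le_one _ hkm (fun q => hk0 _ _) fun q => hk1 _ _)]
    refine integral_congr_ae (Eventually.of_forall fun g => ?_)
    simp only [hk]
    rw [integral_prod_mul, sq]
  have hF2 : Integrable (fun g => (∫ x, f g x ∂μ) ^ 2) ν :=
    integrable_of_nonneg_of_le_one _ (hFm.pow_const 2) (fun g => sq_nonneg _)
      fun g => pow_le_one₀ (hF0 g) (hF1 g)
  have hFi : Integrable (fun g => (2 * p) * ∫ x, f g x ∂μ) ν :=
    (integrable_of_nonneg_of_le_one _ hFm hF0 hF1).const_mul _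
  have hexp : ∀ g, (∫ x, f g x ∂μ - p) ^ 2
      = ((∫ x, f g x ∂μ) ^ 2 - (2 * p) * ∫ x, f g x ∂μ) + p ^ 2 := fun g => by ring
  simp_rw [hexp]
  have hFd : Integrable (fun g => (∫ x, f g x ∂μ) ^ 2 - (2 * p) * ∫ x, f g x ∂μ) ν :=
    hF2.sub hFi
  rw [integral_add hFd (integrable_const _), integral_sub hF2 hFi, integral_const_mul, hA, hB,
    integral_sub hJi (integrable_const _)]
  simp only [integral_const, probReal_univ, smul_eq_mul, one_mul]
  ring

section RandomAverage

variable {N : ℕ} {X : Type*} [MeasurableSpace X] {μ : Measure X} [IsProbabilityMeasure μ]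
  {e : X → EuclideanSpace ℝ (Fin N)}

/-- For `e : X → ℝ^N`, the distribution function at `u` of the random variable `x ↦ ⟨e x, g⟩` on
the probability space `(X, μ)`. -/
def linCDF (μ : Measure X) (e : X → EuclideanSpace ℝ (Fin N)) (g : EuclideanSpace ℝ (Fin N))
    (u : ℝ) : ℝ :=
  μ.real {x | inner ℝ (e x) g ≤ u}

omit [IsProbabilityMeasure μ] in
theorem linCDF_nonneg (g : EuclideanSpace ℝ (Fin N)) (u : ℝ) : 0 ≤ linCDF μ e g u :=
  measureReal_nonneg

theorem linCDF_le_one (g : EuclideanSpace ℝ (Fin N)) (u : ℝ) : linCDF μ e g u ≤ 1 :=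
  measureReal_le_one

theorem monotone_linCDF (g : EuclideanSpace ℝ (Fin N)) : Monotone (linCDF μ e g) :=
  fun _ _ h => measureReal_mono fun _ hx => le_trans hx h

theorem measurable_linCDF (he : Measurable e) :
    Measurable fun q : EuclideanSpace ℝ (Fin N) × ℝ => linCDF μ e q.1 q.2 := by
  have hs : MeasurableSet {q : (EuclideanSpace ℝ (Fin N) × ℝ) × X |
      inner ℝ (e q.2) q.1.1 ≤ q.1.2} :=
    measurableSet_le ((he.comp measurable_snd).inner (measurable_fst.comp measurable_fst))
      (measurable_snd.comp measurable_fst)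
  exact (measurable_measure_prodMk_left hs).ennreal_toReal

/-- If the unit vectors `e x` have mean zero inner products and mean square inner products `δ`, then
the distribution function of a random Gaussian combination of their coordinates has variance
`O(δ)`. -/
theorem integral_linCDF_sub_sq_le (he : Measurable e) (hnorm : ∀ x, ‖e x‖ = 1) {δ : ℝ}
    (hzero : ∀ x, ∫ y, inner ℝ (e x) (e y) ∂μ = 0)
    (hsq : ∀ x, ∫ y, inner ℝ (e x) (e y) ^ 2 ∂μ = δ) (u : ℝ) :
    ∫ g, (linCDF μ e g u - gaussCDF u) ^ 2 ∂(stdGaussian (EuclideanSpace ℝ (Fin N)))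
      ≤ δ * (20 + 10 * u ^ 2) := by
  set f : EuclideanSpace ℝ (Fin N) → X → ℝ :=
    fun g x => Set.indicator {g | inner ℝ (e x) g ≤ u} 1 g with hf
  have hfm : Measurable (Function.uncurry f) := by
    have hs : MeasurableSet {q : EuclideanSpace ℝ (Fin N) × X | inner ℝ (e q.2) q.1 ≤ u} :=
      measurableSet_le ((he.comp measurable_snd).inner measurable_fst) measurable_const
    exact measurable_one.indicator hs
  have hs1 : ∀ x, MeasurableSet {g : EuclideanSpace ℝ (Fin N) | inner ℝ (e x) g ≤ u} := fun x =>
    measurableSet_le (by fun_prop) measurable_const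
  have hs2 : ∀ g, MeasurableSet {x : X | inner ℝ (e x) g ≤ u} := fun g =>
    measurableSet_le (he.inner measurable_const) measurable_const
  have h0 : ∀ g x, 0 ≤ f g x := fun g x => Set.indicator_nonneg (fun _ _ => zero_le_one) _
  have h1 : ∀ g x, f g x ≤ 1 := fun g x =>
    Set.indicator_le_self' (f := 1) (fun _ _ => zero_le_one) _
  have hp : ∀ x, ∫ g, f g x ∂(stdGaussian (EuclideanSpace ℝ (Fin N))) = gaussCDF u := fun x => by
    rw [← gaussCDF_eq_stdGaussian (hnorm x) u]
    exact integral_indicator_one (hs1 x)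
  have hlin : ∀ g, ∫ x, f g x ∂μ = linCDF μ e g u := fun g =>
    integral_indicator_one (hs2 g)
  have hjoint : ∀ x y, ∫ g, f g x * f g y ∂(stdGaussian (EuclideanSpace ℝ (Fin N)))
      = jointCDF (e x) (e y) u := fun x y => by
    refine Eq.trans (integral_congr_ae (Eventually.of_forall fun g => ?_))
      (integral_indicator_one ((hs1 x).inter (hs1 y)))
    exact (congrFun Set.inter_indicator_one g).symm
  obtain ⟨hmain, hint⟩ := integral_sq_integral_sub (μ := μ) hfm h0 h1 hp
  simp_rw [hlin, hjoint] at hmain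
  simp_rw [hjoint] at hint
  have him : Measurable fun z : X × X => inner ℝ (e z.1) (e z.2) :=
    (he.comp measurable_fst).inner (he.comp measurable_snd)
  have hi1 : Integrable (fun z : X × X => inner ℝ (e z.1) (e z.2)) (μ.prod μ) := by
    refine Integrable.of_bound him.aestronglyMeasurable 1 (Eventually.of_forall fun z => ?_)
    have := norm_inner_le_norm (𝕜 := ℝ) (e z.1) (e z.2)
    rwa [hnorm, hnorm, mul_one] at this
  have hi2 : Integrable (fun z : X × X => inner ℝ (e z.1) (e z.2) ^ 2) (μ.prod μ) := by
    refine integrable_of_nonneg_of_le_one _ (him.pow_const 2) (fun z => sq_nonneg _) fun z => ?_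
    have := abs_real_inner_le_norm (e z.1) (e z.2)
    rw [hnorm, hnorm, mul_one] at this
    rwa [sq_le_one_iff_abs_le_one]
  rw [hmain]
  calc _ ≤ ∫ z : X × X, (inner ℝ (e z.1) (e z.2) ^ 2 * (20 + 10 * u ^ 2)
          - inner ℝ (e z.1) (e z.2) * jointCoeff u) ∂(μ.prod μ) := by
        refine integral_mono hint ((hi2.mul_const _).sub (hi1.mul_const _)) fun z => ?_
        have := (abs_le.mp (abs_jointCDF_sub_le (hnorm z.1) (hnorm z.2) u)).2
        simp only
        linarith
    _ = δ * (20 + 10 * u ^ 2) := by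
        rw [integral_sub (hi2.mul_const _) (hi1.mul_const _), integral_mul_const,
          integral_mul_const, integral_prod _ hi1, integral_prod _ hi2]
        simp [hzero, hsq]

/-- Markov's inequality for the Cramér–von Mises distance. -/
theorem stdGaussian_cramerVonMises_ge (he : Measurable e) (hnorm : ∀ x, ‖e x‖ = 1) {δ : ℝ}
    (hzero : ∀ x, ∫ y, inner ℝ (e x) (e y) ∂μ = 0)
    (hsq : ∀ x, ∫ y, inner ℝ (e x) (e y) ^ 2 ∂μ = δ) {c : ℝ} (hc : 0 < c) :
    (stdGaussian (EuclideanSpace ℝ (Fin N))).real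
      {g | c ≤ ∫ u, (linCDF μ e g u - gaussCDF u) ^ 2 ∂(gaussianReal 0 1)} ≤ 30 * δ / c := by
  set D : EuclideanSpace ℝ (Fin N) × ℝ → ℝ :=
    fun q => (linCDF μ e q.1 q.2 - gaussCDF q.2) ^ 2 with hD
  have hDm : Measurable D :=
    ((measurable_linCDF he).sub (continuous_gaussCDF.measurable.comp measurable_snd)).pow_const 2
  have hD1 : ∀ q, D q ≤ 1 := fun q => by
    simp only [hD]
    rw [sq_le_one_iff_abs_le_one, abs_le]
    constructor <;> linarith [linCDF_nonneg (μ := μ) (e := e) q.1 q.2,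
      linCDF_le_one (μ := μ) (e := e) q.1 q.2, gaussCDF_nonneg q.2, gaussCDF_le_one q.2]
  have hDi := integrable_of_nonneg_of_le_one ((stdGaussian (EuclideanSpace ℝ (Fin N))).prod
    (gaussianReal 0 1)) hDm (fun q => sq_nonneg _) hD1
  have hmean : ∫ g, ∫ u, D (g, u) ∂(gaussianReal 0 1) ∂(stdGaussian (EuclideanSpace ℝ (Fin N)))
      ≤ 30 * δ := by
    rw [integral_integral_swap (f := fun g u => D (g, u)) hDi]
    calc _ ≤ ∫ u, δ * (20 + 10 * u ^ 2) ∂(gaussianReal 0 1) :=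
          integral_mono hDi.integral_prod_right
            (((integrable_const _).add (integrable_sq_gaussianReal.const_mul 10)).const_mul δ)
            fun u => integral_linCDF_sub_sq_le he hnorm hzero hsq u
      _ = 30 * δ := by
          rw [integral_const_mul, integral_add (integrable_const _)
            (integrable_sq_gaussianReal.const_mul 10), integral_const_mul,
            integral_sq_gaussianReal]
          simp
          ring
  rw [le_div_iff₀ hc, mul_comm]
  exact (mul_meas_ge_le_integral_of_nonneg
    (Eventually.of_forall fun g => integral_nonneg fun u => sq_nonneg _)
    hDi.integral_prod_left c).trans hmean

end RandomAverage

theorem tendsto_gaussCDF_atTop : Tendsto gaussCDF atTop (nhds 1) := by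
  have h := tendsto_cdf_atTop (gaussianReal 0 1)
  rwa [show (cdf (gaussianReal 0 1) : ℝ → ℝ) = gaussCDF from funext fun u => cdf_eq_real _ u] at h

theorem tendsto_gaussCDF_atBot : Tendsto gaussCDF atBot (nhds 0) := by
  have h := tendsto_cdf_atBot (gaussianReal 0 1)
  rwa [show (cdf (gaussianReal 0 1) : ℝ → ℝ) = gaussCDF from funext fun u => cdf_eq_real _ u] at h

theorem monotone_gaussCDF : Monotone gaussCDF := fun _ _ h =>
  measureReal_mono (Set.Iic_subset_Iic.mpr h)

theorem exists_gaussCDF_eq {p : ℝ} (h0 : 0 < p) (h1 : p < 1) : ∃ u, gaussCDF u = p := by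
  obtain ⟨a, ha⟩ := (tendsto_gaussCDF_atBot.eventually (gt_mem_nhds h0)).exists
  obtain ⟨b, hb⟩ := (tendsto_gaussCDF_atTop.eventually (lt_mem_nhds h1)).exists
  exact mem_range_of_exists_le_of_exists_ge continuous_gaussCDF ⟨a, ha.le⟩ ⟨b, hb.le⟩

/-- The Cramér–von Mises distance to the Gaussian law dominates the cube of the Kolmogorov
distance: where the distribution functions differ by `η`, they differ by `η / 2` on an interval of
Gaussian measure `η / 2`, since both are monotone. -/
theorem cube_le_integral_sq {F : ℝ → ℝ} (hF : Monotone F) (hF0 : ∀ u, 0 ≤ F u)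
    (hF1 : ∀ u, F u ≤ 1) {η u : ℝ} (hη : 0 < η) (h : η < |F u - gaussCDF u|) :
    η ^ 3 / 8 ≤ ∫ v, (F v - gaussCDF v) ^ 2 ∂(gaussianReal 0 1) := by
  have hint : Integrable (fun v => (F v - gaussCDF v) ^ 2) (gaussianReal 0 1) := by
    refine Integrable.of_bound
      ((hF.measurable.sub continuous_gaussCDF.measurable).pow_const 2).aestronglyMeasurable 1
      (Eventually.of_forall fun v => ?_)
    rw [Real.norm_of_nonneg (sq_nonneg _), sq_le_one_iff_abs_le_one, abs_le]
    constructor <;> linarith [hF0 v, hF1 v, gaussCDF_nonneg v, gaussCDF_le_one v]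
  have key : ∀ a b, gaussCDF b - gaussCDF a = η / 2 →
      (∀ v ∈ Set.Ioc a b, (η / 2) ^ 2 ≤ (F v - gaussCDF v) ^ 2) →
      η ^ 3 / 8 ≤ ∫ v, (F v - gaussCDF v) ^ 2 ∂(gaussianReal 0 1) := by
    intro a b hab hv
    have hle : a ≤ b := by
      by_contra hlt
      have := monotone_gaussCDF (not_le.mp hlt).le
      linarith
    have hm : (gaussianReal 0 1).real (Set.Ioc a b) = η / 2 := by
      rw [← hab, gaussCDF, gaussCDF, ← Set.Iic_sdiff_Iic,
        measureReal_sdiff (Set.Iic_subset_Iic.mpr hle) measurableSet_Iic]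
    calc η ^ 3 / 8 = ∫ _ in Set.Ioc a b, (η / 2) ^ 2 ∂(gaussianReal 0 1) := by
          rw [setIntegral_const, hm, smul_eq_mul]; ring
      _ ≤ ∫ v in Set.Ioc a b, (F v - gaussCDF v) ^ 2 ∂(gaussianReal 0 1) :=
          setIntegral_mono_on (integrable_const _).integrableOn hint.integrableOn
            measurableSet_Ioc hv
      _ ≤ _ := setIntegral_le_integral hint (Eventually.of_forall fun v => sq_nonneg _)
  have h0 := gaussCDF_nonneg u
  have h1 := gaussCDF_le_one u
  have h2 := hF0 u
  have h3 := hF1 u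
  rcases lt_abs.mp h with h | h
  · obtain ⟨w, hw⟩ := exists_gaussCDF_eq (p := gaussCDF u + η / 2) (by linarith) (by linarith)
    refine key u w (by linarith) fun v hv => ?_
    have := hF hv.1.le
    have := monotone_gaussCDF hv.2
    exact pow_le_pow_left₀ (by linarith) (by linarith) 2
  · obtain ⟨w, hw⟩ := exists_gaussCDF_eq (p := gaussCDF u - η / 2) (by linarith) (by linarith)
    refine key w u (by linarith) fun v hv => ?_
    have := hF hv.2
    have := monotone_gaussCDF hv.1.le
    rw [← neg_sq (F v - gaussCDF v)]
    exact pow_le_pow_left₀ (by linarith) (by linarith) 2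

/-- The norm of a standard Gaussian vector concentrates around `√N`, by Chebyshev's inequality for
its square. -/
theorem stdGaussian_abs_norm_div_sub_one_ge {N : ℕ} (hN : N ≠ 0) {δ : ℝ} (hδ : 0 < δ) :
    (stdGaussian (EuclideanSpace ℝ (Fin N))).real {g | δ ≤ |‖g‖ / √N - 1|} ≤
      Var[fun x => x ^ 2; gaussianReal 0 1] / (N * δ ^ 2) := by
  have hN' : (0 : ℝ) < N := by positivity
  set S : (Fin N → ℝ) → ℝ := ∑ i, fun x => x i ^ 2 with hS
  have hmem : MemLp (fun x : ℝ => x ^ 2) 2 (gaussianReal 0 1) := by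
    rw [memLp_two_iff_integrable_sq (by fun_prop)]
    have h := (memLp_id_gaussianReal (μ := 0) (v := 1) 4).integrable_norm_pow (p := 4) (by norm_num)
    refine h.congr (Eventually.of_forall fun x => ?_)
    simp only [id, Real.norm_eq_abs, ← pow_mul]
    exact Even.pow_abs (by decide) x
  have hcomp : ∀ i : Fin N, MemLp (fun x : Fin N → ℝ => x i ^ 2) 2
      (Measure.pi fun _ : Fin N => gaussianReal 0 1) := fun i =>
    hmem.comp_measurePreserving (measurePreserving_eval (fun _ : Fin N => gaussianReal 0 1) i)
  have hSmem : MemLp S 2 (Measure.pi fun _ : Fin N => gaussianReal 0 1) :=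
    memLp_finsetSum' _ fun i _ => hcomp i
  have hvar : Var[S; Measure.pi fun _ : Fin N => gaussianReal 0 1]
      = N * Var[fun x => x ^ 2; gaussianReal 0 1] := by
    rw [hS, variance_sum_pi (X := fun _ x => x ^ 2) fun _ => hmem]
    simp
  have hmean : ∫ x, S x ∂(Measure.pi fun _ : Fin N => gaussianReal 0 1) = N := by
    simp only [hS, Finset.sum_apply]
    rw [integral_finsetSum _ fun i _ => (hcomp i).integrable (by norm_num)]
    have : ∀ i : Fin N, ∫ x : Fin N → ℝ, x i ^ 2 ∂(Measure.pi fun _ : Fin N => gaussianReal 0 1)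
        = 1 := fun i => by
      rw [← integral_sq_gaussianReal]
      exact integral_comp_eval (μ := fun _ : Fin N => gaussianReal 0 1) (i := i)
        (f := fun x : ℝ => x ^ 2) (by fun_prop)
    simp [this]
  have hcheb := meas_ge_le_variance_div_sq hSmem (c := N * δ) (by positivity)
  rw [hmean, hvar] at hcheb
  have hset : MeasurableSet {g : EuclideanSpace ℝ (Fin N) | δ ≤ |‖g‖ / √N - 1|} :=
    measurableSet_le measurable_const (by fun_prop)
  rw [← map_pi_eq_stdGaussian, map_measureReal_apply (by fun_prop) hset]
  have hsub : WithLp.toLp 2 ⁻¹' {g : EuclideanSpace ℝ (Fin N) | δ ≤ |‖g‖ / √N - 1|}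
      ⊆ {x : Fin N → ℝ | N * δ ≤ |S x - N|} := by
    intro x hx
    simp only [Set.mem_preimage, Set.mem_ofPred_eq] at hx ⊢
    have hSx : S x = ‖(WithLp.toLp 2 x : EuclideanSpace ℝ (Fin N))‖ ^ 2 := by
      rw [EuclideanSpace.real_norm_sq_eq]
      simp [hS]
    set r := ‖(WithLp.toLp 2 x : EuclideanSpace ℝ (Fin N))‖ / √N with hr
    have hr0 : 0 ≤ r := by positivity
    have hr2 : S x - N = N * ((r - 1) * (r + 1)) := by
      rw [hSx]
      have : r ^ 2 = ‖(WithLp.toLp 2 x : EuclideanSpace ℝ (Fin N))‖ ^ 2 / N := by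
        rw [hr, div_pow, Real.sq_sqrt hN'.le]
      have h2 : (r - 1) * (r + 1) = r ^ 2 - 1 := by ring
      rw [h2, this]
      field_simp
    rw [hr2, abs_mul, abs_of_pos hN', abs_mul, abs_of_nonneg (by linarith : 0 ≤ r + 1)]
    have : |r - 1| ≤ |r - 1| * (r + 1) := by nlinarith [abs_nonneg (r - 1)]
    exact mul_le_mul_of_nonneg_left (hx.trans this) hN'.le
  calc _ ≤ (Measure.pi fun _ : Fin N => gaussianReal 0 1).real {x | N * δ ≤ |S x - N|} :=
        measureReal_mono hsub
    _ ≤ N * Var[fun x => x ^ 2; gaussianReal 0 1] / (N * δ) ^ 2 := by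
        refine ENNReal.toReal_le_of_le_ofReal ?_ hcheb
        have := variance_nonneg (fun x : ℝ => x ^ 2) (gaussianReal 0 1)
        positivity
    _ = _ := by field_simp

end

/-! ### Gaussian vectors in polar coordinates -/

section

section Polar

/-- The density of the standard Gaussian law on `ℝ^N`, as a function of the norm. -/
def gaussRadial (N : ℕ) (r : ℝ) : ℝ :=
  ((2 * Real.pi) ^ ((N : ℝ) / 2))⁻¹ * Real.exp (-(1 / 2) * r ^ 2)

theorem gaussRadial_nonneg (N : ℕ) (r : ℝ) : 0 ≤ gaussRadial N r := by
  unfold gaussRadial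
  positivity

theorem continuous_gaussRadial (N : ℕ) : Continuous (gaussRadial N) := by
  unfold gaussRadial
  fun_prop

variable {N : ℕ}

theorem stdGaussian_eq_withDensity :
    stdGaussian (EuclideanSpace ℝ (Fin N)) =
      (volume : Measure (EuclideanSpace ℝ (Fin N))).withDensity
        fun x => ENNReal.ofReal (gaussRadial N ‖x‖) := by
  have hb : 0 < (1 / 2 : ℂ).re := by norm_num
  have hint : Integrable (fun x : EuclideanSpace ℝ (Fin N) => gaussRadial N ‖x‖) := by
    have h := (GaussianFourier.integrable_cexp_neg_mul_sq_norm_add (V := EuclideanSpace ℝ (Fin N)) hb 0 0).norm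
    refine (h.const_mul ((2 * Real.pi) ^ ((N : ℝ) / 2))⁻¹).congr (Eventually.of_forall fun x => ?_)
    simp only [gaussRadial, Complex.norm_exp]
    congr 2
    simp [← Complex.ofReal_pow]
  have := isFiniteMeasure_withDensity_ofReal hint.2
  refine Measure.ext_of_charFun (funext fun t => ?_)
  rw [charFun_stdGaussian, charFun_apply]
  have hm : Measurable fun x : EuclideanSpace ℝ (Fin N) => Real.toNNReal (gaussRadial N ‖x‖) :=
    ((continuous_gaussRadial N).comp continuous_norm).measurable.real_toNNReal
  have h1 : ∀ v : EuclideanSpace ℝ (Fin N),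
      (Real.toNNReal (gaussRadial N ‖v‖)) • Complex.exp (inner ℝ v t * Complex.I)
      = ((((2 * Real.pi) ^ ((N : ℝ) / 2))⁻¹ : ℝ) : ℂ)
        * Complex.exp (-(1 / 2 : ℂ) * ‖v‖ ^ 2 + Complex.I * inner ℝ t v) := fun v => by
    rw [NNReal.smul_def, Real.coe_toNNReal _ (gaussRadial_nonneg _ _), gaussRadial,
      Complex.real_smul, Complex.exp_add, real_inner_comm]
    push_cast
    ring_nf
  change _ = ∫ v, _ ∂(volume.withDensity fun x : EuclideanSpace ℝ (Fin N) =>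
    ((Real.toNNReal (gaussRadial N ‖x‖) : NNReal) : ENNReal))
  rw [integral_withDensity_eq_integral_smul hm]
  simp_rw [h1]
  rw [integral_const_mul, GaussianFourier.integral_cexp_neg_mul_sq_norm_add hb]
  have h2 : ((Real.pi : ℂ) / (1 / 2)) ^ ((Module.finrank ℝ (EuclideanSpace ℝ (Fin N)) : ℂ) / 2)
      = (((2 * Real.pi) ^ ((N : ℝ) / 2) : ℝ) : ℂ) := by
    rw [Complex.ofReal_cpow (by positivity)]
    simp
    ring_nf
  rw [h2, ← mul_assoc, ← Complex.ofReal_mul, inv_mul_cancel₀ (by positivity)]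
  simp only [Complex.ofReal_one, one_mul, Complex.I_sq]
  congr 1
  ring

/-- Polar coordinates for the standard Gaussian law: it is a product of the surface measure and of a
measure on the radii. -/
theorem exists_stdGaussian_polar [NeZero N] :
    ∃ η : Measure (Set.Ioi (0 : ℝ)), SFinite η ∧ ∀ T : Set (EuclideanSpace ℝ (Fin N)),
      MeasurableSet T → stdGaussian (EuclideanSpace ℝ (Fin N)) T =
        ((volume : Measure (EuclideanSpace ℝ (Fin N))).toSphere.prod η)
          {p | (p.2 : ℝ) • (p.1 : EuclideanSpace ℝ (Fin N)) ∈ T} := by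
  have hnt : Nontrivial (EuclideanSpace ℝ (Fin N)) :=
    Module.nontrivial_of_finrank_pos (R := ℝ) (by simp [Nat.pos_of_ne_zero (NeZero.ne N)])
  have hk : Measurable fun r : Set.Ioi (0 : ℝ) => ENNReal.ofReal (gaussRadial N r) :=
    ((continuous_gaussRadial N).measurable.comp measurable_subtype_coe).ennreal_ofReal
  refine ⟨(Measure.volumeIoiPow (Module.finrank ℝ (EuclideanSpace ℝ (Fin N)) - 1)).withDensity
    fun r => ENNReal.ofReal (gaussRadial N r), inferInstance, fun T hT => ?_⟩
  have hmp := (volume : Measure (EuclideanSpace ℝ (Fin N))).measurePreserving_homeomorphUnitSphereProd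
  have hset : MeasurableSet {p : USphere N × Set.Ioi (0 : ℝ) |
      (p.2 : ℝ) • (p.1 : EuclideanSpace ℝ (Fin N)) ∈ T} := by
    apply measurableSet_preimage (f := fun p : USphere N × Set.Ioi (0 : ℝ) =>
      (p.2 : ℝ) • (p.1 : EuclideanSpace ℝ (Fin N))) _ hT
    fun_prop
  have hpre : homeomorphUnitSphereProd (EuclideanSpace ℝ (Fin N)) ⁻¹'
      {p : USphere N × Set.Ioi (0 : ℝ) | (p.2 : ℝ) • (p.1 : EuclideanSpace ℝ (Fin N)) ∈ T}
      = Subtype.val ⁻¹' T := by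
    ext x
    have h := congrArg Subtype.val
      ((homeomorphUnitSphereProd (EuclideanSpace ℝ (Fin N))).symm_apply_apply x)
    rw [homeomorphUnitSphereProd_symm_apply_coe] at h
    simp only [Set.mem_preimage, Set.mem_ofPred_eq, h]
  have hae : (Subtype.val '' ((Subtype.val : ({0}ᶜ : Set (EuclideanSpace ℝ (Fin N))) → _) ⁻¹' T) :
      Set (EuclideanSpace ℝ (Fin N))) =ᵐ[volume] T := by
    rw [Subtype.image_preimage_coe]
    have h0 : ∀ᵐ x : EuclideanSpace ℝ (Fin N), x ≠ 0 := by
      rw [ae_iff]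
      simp
    filter_upwards [h0] with x hx
    exact propext ⟨fun h => h.2, fun h => ⟨hx, h⟩⟩
  rw [prod_withDensity_right hk, withDensity_apply _ hset]
  rw [← hmp.setLIntegral_comp_preimage hset (f := fun p => ENNReal.ofReal (gaussRadial N p.2))
    (hk.comp measurable_snd), hpre]
  simp only [homeomorphUnitSphereProd_apply_snd_coe]
  rw [setLIntegral_subtype (measurableSet_singleton _).compl _
      (fun x => ENNReal.ofReal (gaussRadial N ‖x‖)), setLIntegral_congr hae,
    stdGaussian_eq_withDensity, withDensity_apply _ hT]

/-- The direction of a standard Gaussian vector is uniform. Stated as an inequality between outer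
measures, so that neither set has to be measurable. -/
theorem unif_le_stdGaussian [NeZero N] (s : Set (USphere N))
    (T : Set (EuclideanSpace ℝ (Fin N)))
    (h : ∀ α ∈ s, ∀ r : ℝ, 0 < r → r • (α : EuclideanSpace ℝ (Fin N)) ∈ T) :
    unif N s ≤ stdGaussian (EuclideanSpace ℝ (Fin N)) T := by
  obtain ⟨η, hη, hpolar⟩ := exists_stdGaussian_polar (N := N)
  set τ := (volume : Measure (EuclideanSpace ℝ (Fin N))).toSphere with hτ
  have h1 : τ Set.univ * η Set.univ = 1 := by
    have := hpolar Set.univ MeasurableSet.univ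
    rw [measure_univ] at this
    rw [this, ← Measure.prod_prod]
    simp
  have h2 : η Set.univ = (τ Set.univ)⁻¹ := by
    rw [mul_comm] at h1
    exact ENNReal.eq_inv_of_mul_eq_one_left h1
  calc unif N s = (τ.prod η) (s ×ˢ Set.univ) := by
        rw [Measure.prod_prod, h2, unif, Measure.smul_apply, smul_eq_mul, mul_comm]
    _ ≤ (τ.prod η) {p | (p.2 : ℝ) • (p.1 : EuclideanSpace ℝ (Fin N)) ∈
          toMeasurable (stdGaussian (EuclideanSpace ℝ (Fin N))) T} :=
        measure_mono fun p hp => subset_toMeasurable _ _ (h p.1 hp.1 p.2 p.2.2)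
    _ = stdGaussian (EuclideanSpace ℝ (Fin N)) T := by
        rw [← hpolar _ (measurableSet_toMeasurable _ _), measure_toMeasurable]

end Polar

end

/-! ### The Kolmogorov distance of a random eigenfunction -/

section

theorem abs_measureReal_Iic_sub_le_one (P Q : Measure ℝ) [IsProbabilityMeasure P]
    [IsProbabilityMeasure Q] (u : ℝ) :
    |P.real (Set.Iic u) - Q.real (Set.Iic u)| ≤ 1 := by
  have h1 : P.real (Set.Iic u) ≤ 1 := measureReal_le_one
  have h2 : Q.real (Set.Iic u) ≤ 1 := measureReal_le_one
  have h3 : 0 ≤ P.real (Set.Iic u) := measureReal_nonneg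
  have h4 : 0 ≤ Q.real (Set.Iic u) := measureReal_nonneg
  rw [abs_le]
  constructor <;> linarith

theorem unif_real_le_one (N : ℕ) (s : Set (USphere N)) : (unif N).real s ≤ 1 := by
  rcases N with _ | N
  · have : IsEmpty (USphere 0) := ⟨fun x => ne_zero_of_mem_unit_sphere x (Subsingleton.elim _ _)⟩
    rw [Measure.eq_zero_of_isEmpty (unif 0)]
    simp
  · exact measureReal_le_one

variable {d ℓ N : ℕ} {Y : Fin N → USphere (d + 1) → ℝ}

theorem IsHarmonicBasis.continuous_eigenfun (hY : IsHarmonicBasis d ℓ Y) (α : USphere N) :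
    Continuous (eigenfun Y α) := by
  have hc := hY.continuous
  unfold eigenfun
  fun_prop

theorem IsHarmonicBasis.kolToGaussian_le_one (hY : IsHarmonicBasis d ℓ Y) (α : USphere N) :
    kolToGaussian (eigenfun Y α) ≤ 1 := by
  have := Measure.isProbabilityMeasure_map (μ := unif (d + 1))
    (hY.continuous_eigenfun α).measurable.aemeasurable
  exact ciSup_le fun u => abs_measureReal_Iic_sub_le_one _ _ u

theorem inner_featureVec_smul (α : USphere N) (r : ℝ) (x : USphere (d + 1)) :
    inner ℝ (featureVec Y x) (r • (α : EuclideanSpace ℝ (Fin N))) = r / √N * eigenfun Y α x := by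
  simp only [featureVec, eigenfun, PiLp.inner_apply, RCLike.inner_apply, conj_trivial,
    PiLp.smul_apply, smul_eq_mul, Finset.mul_sum]
  exact Finset.sum_congr rfl fun m _ => by ring

/-- If `h_α` is far from Gaussian, then so are all of its multiples `⟨e x, r α⟩` for which `r` is
close to `√N`. -/
theorem IsHarmonicBasis.cramerVonMises_ge (hY : IsHarmonicBasis d ℓ Y) (hN : N ≠ 0)
    {ε : ℝ} (hε : 0 < ε) (hε1 : ε < 1) {α : USphere N}
    (hα : ε < kolToGaussian (eigenfun Y α)) {r : ℝ} (hr : 0 < r) (hr1 : |r / √N - 1| < ε / 2) :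
    ε ^ 3 / 64 ≤ ∫ u, (linCDF (unif (d + 1)) (featureVec Y)
      (r • (α : EuclideanSpace ℝ (Fin N))) u - gaussCDF u) ^ 2 ∂(gaussianReal 0 1) := by
  obtain ⟨u, hu⟩ := exists_lt_of_lt_ciSup hα
  set t := r / √N with ht
  have ht0 : 0 < t := by positivity
  have h1 : ((unif (d + 1)).map (eigenfun Y α)).real (Set.Iic u)
      = linCDF (unif (d + 1)) (featureVec Y) (r • (α : EuclideanSpace ℝ (Fin N))) (t * u) := by
    rw [map_measureReal_apply (hY.continuous_eigenfun α).measurable measurableSet_Iic, linCDF]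
    congr 1
    ext x
    simp only [Set.mem_preimage, Set.mem_Iic, Set.mem_ofPred_eq, inner_featureVec_smul]
    exact (mul_le_mul_iff_right₀ ht0).symm
  rw [h1] at hu
  have h2 := abs_gaussCDF_mul_sub_le u t (by linarith)
  have h3 : ε / 2 < |linCDF (unif (d + 1)) (featureVec Y)
      (r • (α : EuclideanSpace ℝ (Fin N))) (t * u) - gaussCDF (t * u)| := by
    have h4 := abs_sub_le (linCDF (unif (d + 1)) (featureVec Y)
      (r • (α : EuclideanSpace ℝ (Fin N))) (t * u)) (gaussCDF (t * u)) (gaussCDF u)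
    have h5 : gaussCDF u = (gaussianReal 0 1).real (Set.Iic u) := rfl
    rw [← h5] at hu
    linarith
  have h6 := cube_le_integral_sq (monotone_linCDF _) (linCDF_nonneg _) (linCDF_le_one _)
    (by linarith) h3
  refine le_trans (le_of_eq ?_) h6
  ring

theorem IsHarmonicBasis.unif_kolToGaussian_gt_le (hY : IsHarmonicBasis d ℓ Y) (hd : 2 ≤ d)
    (hℓ : 1 ≤ ℓ) (hN : N ≠ 0) {ε : ℝ} (hε : 0 < ε) (hε1 : ε < 1) :
    (unif N).real {α | ε < kolToGaussian (eigenfun Y α)} ≤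
      (1920 + 4 * Var[fun x => x ^ 2; gaussianReal 0 1]) / (N * ε ^ 3) := by
  have : NeZero N := ⟨hN⟩
  set T₁ : Set (EuclideanSpace ℝ (Fin N)) := {g | ε ^ 3 / 64 ≤ ∫ u,
    (linCDF (unif (d + 1)) (featureVec Y) g u - gaussCDF u) ^ 2 ∂(gaussianReal 0 1)} with hT₁
  set T₂ : Set (EuclideanSpace ℝ (Fin N)) := {g | ε / 2 ≤ |‖g‖ / √N - 1|} with hT₂
  have hle := unif_le_stdGaussian {α | ε < kolToGaussian (eigenfun Y α)} (T₁ ∪ T₂)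
    fun α hα r hr => by
      by_cases h : ε / 2 ≤ |r / √N - 1|
      · right
        simpa [hT₂, norm_smul, abs_of_pos hr] using h
      · left
        exact hY.cramerVonMises_ge hN hε hε1 hα hr (not_le.mp h)
  have h1 : (stdGaussian (EuclideanSpace ℝ (Fin N))).real T₁ ≤ 30 * (1 / N) / (ε ^ 3 / 64) :=
    stdGaussian_cramerVonMises_ge hY.continuous_featureVec.measurable (hY.norm_featureVec hN)
      (hY.integral_inner_featureVec hd hℓ) (hY.integral_inner_featureVec_sq hN) (by positivity)
  have h2 : (stdGaussian (EuclideanSpace ℝ (Fin N))).real T₂ ≤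
      Var[fun x => x ^ 2; gaussianReal 0 1] / (N * (ε / 2) ^ 2) :=
    stdGaussian_abs_norm_div_sub_one_ge hN (by linarith)
  have hN0 : (0 : ℝ) < N := by positivity
  have hV := variance_nonneg (fun x : ℝ => x ^ 2) (gaussianReal 0 1)
  set V := Var[fun x => x ^ 2; gaussianReal 0 1]
  calc (unif N).real {α | ε < kolToGaussian (eigenfun Y α)}
      ≤ (stdGaussian (EuclideanSpace ℝ (Fin N))).real (T₁ ∪ T₂) :=
        ENNReal.toReal_mono (measure_ne_top _ _) hle
    _ ≤ 30 * (1 / N) / (ε ^ 3 / 64) + V / (N * (ε / 2) ^ 2) :=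
        (measureReal_union_le _ _).trans (add_le_add h1 h2)
    _ = (1920 + 4 * V * ε) / (N * ε ^ 3) := by
        field_simp
        ring
    _ ≤ (1920 + 4 * V) / (N * ε ^ 3) := by
        have : 4 * V * ε ≤ 4 * V := mul_le_of_le_one_right (by positivity) hε1.le
        gcongr

end

end SphericalHarmonics

end

theorem theorem3 :
    ∃ K : ℝ, 0 < K ∧
      (∀ (d ℓ N : ℕ) (Y : Fin N → SphericalHarmonics.USphere (d + 1) → ℝ), 2 ≤ d →
        SphericalHarmonics.IsHarmonicBasis d ℓ Y → ∀ ε : ℝ, 0 < ε →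
          (SphericalHarmonics.unif N).real
              {α | ε < SphericalHarmonics.kolToGaussian (SphericalHarmonics.eigenfun Y α)} ≤
            K / (SphericalHarmonics.harmonicDim d ℓ * ε ^ 3)) ∧
      (∀ d : ℕ, 2 ≤ d → ∀ ε : ℕ → ℝ, (∀ ℓ, 0 < ε ℓ) →
        (fun ℓ : ℕ => K / (SphericalHarmonics.harmonicDim d ℓ * ε ℓ ^ 3)) =O[atTop]
          (fun ℓ : ℕ => 1 / ((ℓ : ℝ) ^ (d - 1) * ε ℓ ^ 3))) ∧
      (∀ ℓ : ℕ, ∀ ε : ℕ → ℝ, (∀ d, 0 < ε d) →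
        (fun d : ℕ => K / (SphericalHarmonics.harmonicDim d ℓ * ε d ^ 3)) =O[atTop]
          (fun d : ℕ => 1 / ((d : ℝ) ^ ℓ * ε d ^ 3))) := by
  have hV := variance_nonneg (fun x : ℝ => x ^ 2) (gaussianReal 0 1)
  refine ⟨1920 + 4 * Var[fun x => x ^ 2; gaussianReal 0 1], by positivity, ?_, ?_, ?_⟩
  · intro d ℓ N Y hd hY ε hε
    have hD := SphericalHarmonics.harmonicDim_pos d ℓ hd
    rcases le_or_gt 1 ε with hε1 | hε1
    · have hempty : {α | ε < SphericalHarmonics.kolToGaussian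
          (SphericalHarmonics.eigenfun Y α)} = ∅ :=
        Set.eq_empty_of_forall_notMem fun α hα =>
          absurd (hY.kolToGaussian_le_one α) (not_le.mpr (hε1.trans_lt hα))
      rw [hempty, measureReal_empty]
      positivity
    rcases Nat.eq_zero_or_pos ℓ with rfl | hℓ
    · -- In degree zero the right-hand side exceeds `1`.
      refine (SphericalHarmonics.unif_real_le_one N _).trans ?_
      have h1 : SphericalHarmonics.harmonicDim d 0 = 1 := by simp [SphericalHarmonics.harmonicDim]
      rw [h1, one_mul, le_div_iff₀ (by positivity), one_mul]
      have h2 : ε ^ 3 ≤ 1 := pow_le_one₀ hε.le hε1.le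
      linarith
    · have hDN := hY.harmonicDim_le hd hℓ
      have hN : N ≠ 0 := by
        rintro rfl
        rw [Nat.cast_zero] at hDN
        linarith
      refine (hY.unif_kolToGaussian_gt_le hd hℓ hN hε hε1).trans ?_
      gcongr
  · intro d hd ε hε
    refine SphericalHarmonics.isBigO_of_pow_le (by positivity)
      (c := 1 / ((d - 1).factorial : ℝ)) (by positivity) _ _ ε hε ?_ ?_
    · filter_upwards [eventually_ge_atTop 1] with ℓ hℓ
      positivity
    · filter_upwards [eventually_ge_atTop 1] with ℓ hℓ
      have := SphericalHarmonics.pow_le_harmonicDim_degree d ℓ hd hℓ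
      rwa [one_div_mul_eq_div]
  · intro ℓ ε hε
    refine SphericalHarmonics.isBigO_of_pow_le (by positivity)
      (c := 1 / (ℓ.factorial : ℝ)) (by positivity) _ _ ε hε ?_ ?_
    · filter_upwards [eventually_ge_atTop 1] with d hd
      positivity
    · filter_upwards [eventually_ge_atTop 2] with d hd
      have := SphericalHarmonics.pow_le_harmonicDim_dim d ℓ hd
      rwa [one_div_mul_eq_div]
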